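/- Let $(B,\omega)$ be a closed, connected symplectic manifold with a Hamiltonian action of the circle $S^1=\mathbb{R}/2\pi\mathbb{Z}$: the action is smooth, and the vector field $X$ generating it satisfies $\omega(X,\cdot)=-\mathrm{d}H$ for a smooth function $H\colon B\to\mathbb{R}$. Let $\pi\colon M\to B$ be a Boothby–Wang bundle over $(B,\omega)$, i.e. a smooth principal $S^1$-bundle with a connection $1$-form $\alpha$ (an $S^1$-invariant real-valued $1$-form equal to $1$ on the vector field generating the principal $S^1$-action) of curvature $\omega$, that is, $\mathrm{d}\alpha=\pi^*\omega$. Assume that the $S^1$-action on $B$ has only finitely many fixed points. Then $H$ can be normalised by adding a constant so that $H>0$ on $B$ and $H(p_0)\in\mathbb{N}$ for at least one fixed point $p_0$. For every such normalisation of $H$ and every irrational $\varepsilon>0$, writing $\tilde H:=H\circ\pi$, the rescaled form $$\frac{\alpha}{\tilde H+\varepsilon}$$ is a contact form on $M$, it has a unique Reeb vector field, and this Reeb vector field has only finitely many periodic orbits (regarded as subsets of $M$). These periodic orbits are exactly the fibres $\pi^{-1}(p)$ over the fixed points $p$ of the $S^1$-action on $B$. -/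

import Mathlib

open Set
open scoped Manifold ContDiff

noncomputable section

namespace BoothbyWang

/-! ### Differential forms on manifolds without boundary -/

section Forms

variable {E : Type*} [NormedAddCommGroup E] [NormedSpace ℝ E]
  {M : Type*} [TopologicalSpace M] [ChartedSpace E M]
  {E' : Type*} [NormedAddCommGroup E'] [NormedSpace ℝ E']
  {N : Type*} [TopologicalSpace N] [ChartedSpace E' N]

/-- A (not necessarily smooth) real differential `k`-form on a manifold `M` modelled on `E`. -/
abbrev DiffForm (E : Type*) [NormedAddCommGroup E] [NormedSpace ℝ E]
    (M : Type*) [TopologicalSpace M] [ChartedSpace E M] (k : ℕ) : Type _ :=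
  (x : M) → (TangentSpace 𝓘(ℝ, E) x) [⋀^Fin k]→L[ℝ] ℝ

/-- Pull-back `f^*η` of a form along a differentiable map. -/
def pullback {k : ℕ} (f : M → N) (η : DiffForm E' N k) : DiffForm E M k :=
  fun x => (η (f x)).compContinuousLinearMap (mfderiv 𝓘(ℝ, E) 𝓘(ℝ, E') f x)

/-- Coordinate expression of a form in the preferred chart `φ` around `x₀`, i.e. the pull-back of
the form along `φ⁻¹`. Only its values on the (open) target of the chart are meaningful. -/
def inChart {k : ℕ} (η : DiffForm E M k) (x₀ : M) : E → E [⋀^Fin k]→L[ℝ] ℝ :=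
  fun y => (η ((extChartAt 𝓘(ℝ, E) x₀).symm y)).compContinuousLinearMap
    (mfderiv 𝓘(ℝ, E) 𝓘(ℝ, E) (extChartAt 𝓘(ℝ, E) x₀).symm y)

/-- A form is smooth if all its coordinate expressions are. -/
def IsSmoothForm {k : ℕ} (η : DiffForm E M k) : Prop :=
  ∀ x₀ : M, ContDiffOn ℝ ∞ (inChart η x₀) (extChartAt 𝓘(ℝ, E) x₀).target

/-- Exterior derivative: at `x`, differentiate the coordinate expression in the chart around `x`
and pull the result back to the manifold. The normalisation is
`dα(X, Y) = X(α(Y)) - Y(α(X)) - α([X, Y])` for `1`-forms. -/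
def extDer {k : ℕ} (η : DiffForm E M k) : DiffForm E M (k + 1) :=
  fun x => (extDeriv (inChart η x) (extChartAt 𝓘(ℝ, E) x x)).compContinuousLinearMap
    (mfderiv 𝓘(ℝ, E) 𝓘(ℝ, E) (extChartAt 𝓘(ℝ, E) x) x)

/-- Symplectic form: a smooth, closed, pointwise non-degenerate `2`-form. -/
structure IsSymplecticForm (σ : DiffForm E M 2) : Prop where
  smooth : IsSmoothForm σ
  closed : ∀ x, extDer σ x = 0
  nondegenerate : ∀ (x : M) (v : TangentSpace 𝓘(ℝ, E) x), (∀ w, σ x ![v, w] = 0) → v = 0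

/-- Contact form: a smooth, nowhere vanishing `1`-form `α` such that `dα` is non-degenerate on the
hyperplanes `ker α`; on a manifold of dimension `2n + 1` this says that `α ∧ (dα)^n` is a volume
form. -/
structure IsContactForm (α : DiffForm E M 1) : Prop where
  smooth : IsSmoothForm α
  ne_zero : ∀ x, α x ≠ 0
  nondegenerate : ∀ (x : M) (v : TangentSpace 𝓘(ℝ, E) x), α x ![v] = 0 →
    (∀ w : TangentSpace 𝓘(ℝ, E) x, α x ![w] = 0 → extDer α x ![v, w] = 0) → v = 0

/-- Smoothness of a vector field, as a section of the tangent bundle. -/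
def IsSmoothField (X : (x : M) → TangentSpace 𝓘(ℝ, E) x) [IsManifold 𝓘(ℝ, E) 1 M] : Prop :=
  ContMDiff 𝓘(ℝ, E) 𝓘(ℝ, E).tangent ∞ (fun x => (⟨x, X x⟩ : TangentBundle 𝓘(ℝ, E) M))

/-- `R` is the Reeb vector field of `α`: `α(R) = 1` and `dα(R, ·) = 0`. -/
structure IsReebField [IsManifold 𝓘(ℝ, E) 1 M] (α : DiffForm E M 1)
    (R : (x : M) → TangentSpace 𝓘(ℝ, E) x) : Prop where
  smooth : IsSmoothField R
  normalised : ∀ x, α x ![R x] = 1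
  kernel : ∀ (x : M) (v : TangentSpace 𝓘(ℝ, E) x), extDer α x ![R x, v] = 0

/-- `O` is (the image of) a periodic orbit of the nowhere vanishing vector field `R`. -/
def IsPeriodicOrbit (R : (x : M) → TangentSpace 𝓘(ℝ, E) x) (O : Set M) : Prop :=
  ∃ (γ : ℝ → M) (T : ℝ), IsMIntegralCurve (I := 𝓘(ℝ, E)) γ R ∧ 0 < T ∧
    Function.Periodic γ T ∧ O = range γ

end Forms

/-! ### Circle actions and principal circle bundles -/

section Actions

variable {E : Type*} [NormedAddCommGroup E] [NormedSpace ℝ E]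
  {M : Type*} [TopologicalSpace M] [ChartedSpace E M] [MulAction Circle M]
  {E' : Type*} [NormedAddCommGroup E'] [NormedSpace ℝ E']
  {B : Type*} [TopologicalSpace B] [ChartedSpace E' B]

/-- The vector field generating an action of `S¹ = ℝ/2πℤ`: its value at `x` is the velocity at
`t = 0` of the curve `t ↦ e^{it} • x`, which passes through `x` at `t = 0`. -/
def generator (E : Type*) [NormedAddCommGroup E] [NormedSpace ℝ E]
    {M : Type*} [TopologicalSpace M] [ChartedSpace E M] [MulAction Circle M]
    (x : M) : TangentSpace 𝓘(ℝ, E) x :=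
  (mfderiv 𝓘(ℝ, ℝ) 𝓘(ℝ, E) (fun t : ℝ => Circle.exp t • x) 0 : ℝ →L[ℝ] E) 1

/-- The circle action on `(B, σ)` is Hamiltonian with Hamiltonian function `H`: the action is
smooth and its generating vector field is the Hamiltonian vector field `X` of `H`, defined by
`σ(X, ·) = -dH`. -/
structure IsHamiltonianCircleAction [MulAction Circle B] (σ : DiffForm E' B 2) (H : B → ℝ) :
    Prop where
  smooth_action : ContMDiffSMul (𝓡 1) 𝓘(ℝ, E') ∞ Circle B
  smooth : ContMDiff 𝓘(ℝ, E') 𝓘(ℝ, ℝ) ∞ H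
  hamiltonian : ∀ (b : B) (v : TangentSpace 𝓘(ℝ, E') b),
    σ b ![generator E' b, v] = -(mfderiv 𝓘(ℝ, E') 𝓘(ℝ, ℝ) H b v : ℝ)

/-- `π : M → B` is a smooth principal circle bundle for the given circle action on `M`: the action
is smooth, preserves the fibres, and every point of the base has an open neighbourhood `U` with an
equivariant diffeomorphism `π⁻¹(U) ≅ U × S¹` over `U`. -/
structure IsPrincipalCircleBundle (E E' : Type*) [NormedAddCommGroup E] [NormedSpace ℝ E]
    [NormedAddCommGroup E'] [NormedSpace ℝ E']
    {M : Type*} [TopologicalSpace M] [ChartedSpace E M] [MulAction Circle M]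
    {B : Type*} [TopologicalSpace B] [ChartedSpace E' B] (π : M → B) : Prop where
  smooth_action : ContMDiffSMul (𝓡 1) 𝓘(ℝ, E) ∞ Circle M
  smooth_proj : ContMDiff 𝓘(ℝ, E) 𝓘(ℝ, E') ∞ π
  proj_smul : ∀ (g : Circle) (x : M), π (g • x) = π x
  locally_trivial : ∀ b : B, ∃ e : Bundle.Trivialization Circle π, b ∈ e.baseSet ∧
    ContMDiffOn 𝓘(ℝ, E) (𝓘(ℝ, E').prod (𝓡 1)) ∞ e e.source ∧
    ContMDiffOn (𝓘(ℝ, E').prod (𝓡 1)) 𝓘(ℝ, E) ∞ e.toOpenPartialHomeomorph.symm e.target ∧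
    ∀ (g : Circle), ∀ x ∈ e.source, (e (g • x)).2 = g * (e x).2

/-- `α` is a connection `1`-form (with values in `ℝ`, the Lie algebra of `S¹ = ℝ/2πℤ`) with
curvature form `σ` on the circle bundle `π : M → B`. -/
structure IsConnectionForm (π : M → B) (σ : DiffForm E' B 2) (α : DiffForm E M 1) : Prop where
  smooth : IsSmoothForm α
  invariant : ∀ g : Circle, pullback (fun x : M => g • x) α = α
  normalised : ∀ x : M, α x ![generator E x] = 1
  curvature : extDer α = pullback π σ

end Actions

/-- The Hamiltonian function is normalised: it is positive, and it takes a natural number as value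
at some fixed point of the circle action. -/
def IsNormalised {B : Type*} [MulAction Circle B] (H : B → ℝ) : Prop :=
  (∀ b, 0 < H b) ∧ ∃ p₀ ∈ MulAction.fixedPoints Circle B, ∃ n : ℕ, H p₀ = n

/-- The rescaled form `α / (H ∘ π + ε)` on the total space of `π : M → B`. -/
def rescaled {E : Type*} [NormedAddCommGroup E] [NormedSpace ℝ E]
    {M : Type*} [TopologicalSpace M] [ChartedSpace E M] {B : Type*}
    (α : DiffForm E M 1) (π : M → B) (H : B → ℝ) (ε : ℝ) : DiffForm E M 1 :=
  fun x => (H (π x) + ε)⁻¹ • α x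

end BoothbyWang

end

/-! Write K = H + c + ε and let X generate the action on B. The Reeb field of α/K is the lift R of X
with α(R) = K: contracting R with d(α/K) leaves σ(X,·)/K + dK/K, which vanishes because σ(X,·) =
-dK. Non-degeneracy of σ makes α/K contact, and this forces uniqueness of R (`isContactForm`,
`isReebField_iff`).

The flow of R covers the circle action on B. It commutes with the principal action and preserves α,
since formally L_R α = d(α(R)) + dα(R,·) = dK - dK = 0. At time 2π it covers the identity, so it
multiplies each fibre by an element hol(b) of the circle. Preservation of α gives d hol = 0, so hol
is constant on the connected base. Over a fixed point p, R is K(p) times the vertical generator,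
hence hol = exp(2πi K(p)). One fixed point therefore determines the holonomy over all of B
(`integralCurve_add_two_pi`), and at p₀ the value K(p₀) = n + ε is irrational.

Suppose an integral curve of R with period T > 0 lies over a point that is not fixed. The times
returning this point to itself form a closed proper subgroup of ℝ containing T and 2π, so nT = 2πm
with m ≠ 0 (`exists_int_mul_eq_of_exp_smul_eq`). The holonomy at time 2πm is then trivial, so m
K(p₀) is an integer, contradicting irrationality. Periodic orbits thus lie over fixed points, where
R rotates the whole fibre with speed K(p) > 0.

Invariance of α is obtained from an explicit flow in local sections, corrected by an integrated
angle (`tder_liftAngle`, `exists_localFlow`). Compactness of B gives a uniform time of existence,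
hence a global flow (`exists_flow`). The normalisation exists because a minimum of H is critical, so
X vanishes there. -/

noncomputable section

namespace BoothbyWang

open scoped Topology

/-! ### Derivatives read in the model spaces -/

section TangentMap

variable {E : Type*} [NormedAddCommGroup E] [NormedSpace ℝ E]
  {M : Type*} [TopologicalSpace M] [ChartedSpace E M]
  {E' : Type*} [NormedAddCommGroup E'] [NormedSpace ℝ E']
  {N : Type*} [TopologicalSpace N] [ChartedSpace E' N]
  {E'' : Type*} [NormedAddCommGroup E''] [NormedSpace ℝ E'']
  {P : Type*} [TopologicalSpace P] [ChartedSpace E'' P]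

/-- The derivative of a map between manifolds, as a linear map between the model spaces. -/
def tder (f : M → N) (x : M) : E →L[ℝ] E' := mfderiv 𝓘(ℝ, E) 𝓘(ℝ, E') f x

theorem tder_comp {g : N → P} {f : M → N} (x : M)
    (hg : MDifferentiableAt 𝓘(ℝ, E') 𝓘(ℝ, E'') g (f x))
    (hf : MDifferentiableAt 𝓘(ℝ, E) 𝓘(ℝ, E') f x) :
    tder (E := E) (E' := E'') (fun y => g (f y)) x =
      (tder (E := E') (E' := E'') g (f x)).comp (tder (E := E) (E' := E') f x) :=
  mfderiv_comp x hg hf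

theorem tder_congr {f g : M → N} {x : M} (h : f =ᶠ[𝓝 x] g) :
    tder (E := E) (E' := E') f x = tder (E := E) (E' := E') g x := by
  rw [tder, tder, h.mfderiv_eq]

theorem tder_eq_fderiv (f : E → E') (x : E) : tder f x = fderiv ℝ f x :=
  mfderiv_eq_fderiv

theorem tder_id (x : M) : tder (E := E) (E' := E) (fun y : M => y) x = .id ℝ E :=
  mfderiv_id

theorem tder_const (x : M) (y : N) : tder (E := E) (E' := E') (fun _ : M => y) x = 0 :=
  mfderiv_const

end TangentMap

/-! ### Pulling back 1-forms to normed spaces; the structure equation -/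

section FormCalculus

variable {W : Type*} [NormedAddCommGroup W] [NormedSpace ℝ W]
  {F : Type*} [NormedAddCommGroup F] [NormedSpace ℝ F]
  {M : Type*} [TopologicalSpace M] [ChartedSpace F M]

/-- The linear functional `v ↦ α x ![v]` given by a `1`-form at a point. -/
def DiffForm.functional (α : DiffForm F M 1) (x : M) : F →L[ℝ] ℝ :=
  (ContinuousAlternatingMap.ofSubsingletonLIE (𝕜 := ℝ) (E := F) (F := ℝ) (0 : Fin 1)).symm (α x)

theorem functional_eq (β : F [⋀^Fin 1]→L[ℝ] ℝ) (v : F) :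
    (ContinuousAlternatingMap.ofSubsingletonLIE (𝕜 := ℝ) (E := F) (F := ℝ) (0 : Fin 1)).symm β v = β ![v] := by
  change β _ = _
  refine congrArg _ (funext fun i => ?_)
  fin_cases i
  rfl

theorem DiffForm.functional_apply (α : DiffForm F M 1) (x : M) (v : F) :
    α.functional x v = α x ![v] :=
  functional_eq (F := F) _ v

/-- The value of a `2`-form on two tangent vectors. -/
def DiffForm.pair (β : DiffForm F M 2) (x : M) (v w : F)   : ℝ := β x ![v, w]

/-- The value of the pull-back of a `1`-form along a map from a normed space on a constant vector
field. -/
def pairing (α : DiffForm F M 1) (c : W → M) (η : W) (w : W) : ℝ :=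
  α.functional (c w) (tder (E := W) (E' := F) c w η)

/-- The coordinate expression of the pull-back of a `1`-form along a map from a normed space. -/
def pullInChart (α : DiffForm F M 1) (c : W → M) (w : W) : W → W [⋀^Fin 1]→L[ℝ] ℝ :=
  fun w' => (inChart α (c w) (extChartAt 𝓘(ℝ, F) (c w) (c w'))).compContinuousLinearMap
        (fderiv ℝ (extChartAt 𝓘(ℝ, F) (c w) ∘ c) w')

theorem contDiffAt_inChart {k : ℕ} {α : DiffForm F M k} (hα : IsSmoothForm α) (x : M) :
    ContDiffAt ℝ ∞ (inChart α x) (extChartAt 𝓘(ℝ, F) x x) :=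
  (hα x).contDiffAt (extChartAt_target_mem_nhds x)

theorem contDiffAt_extChartAt_comp {c : W → M} {w : W}
    (hc : ContMDiffAt 𝓘(ℝ, W) 𝓘(ℝ, F) ∞ c w) :
    ContDiffAt ℝ ∞ (extChartAt 𝓘(ℝ, F) (c w) ∘ c) w :=
  (ContMDiffAt.comp w contMDiffAt_extChartAt hc).contDiffAt

variable [IsManifold 𝓘(ℝ, F) ∞ M]

/-- The chart around `c w` stays fixed while `w'` varies; near `w` the chart and its inverse cancel
by the chain rule. This reduces smoothness and exterior derivatives of pull-backs to calculus on
`W`. -/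
theorem pairing_eventuallyEq {α : DiffForm F M 1} {c : W → M} {w : W}
    (hc : ContMDiffAt 𝓘(ℝ, W) 𝓘(ℝ, F) ∞ c w) :
    ∀ᶠ w' in 𝓝 w, ∀ η : W, pairing α c η w' = pullInChart α c w w' ![η] := by
  have h1 : ∀ᶠ w' in 𝓝 w, ContMDiffAt 𝓘(ℝ, W) 𝓘(ℝ, F) 1 c w' :=
    (contMDiffAt_iff_contMDiffAt_nhds (by simp)).1
      (hc.of_le (by simp : (1 : ℕ∞ω) ≤ ∞))
  have h2 : ∀ᶠ w' in 𝓝 w, c w' ∈ (chartAt F (c w)).source :=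
    hc.continuousAt.eventually (chart_source_mem_nhds F (c w))
  have : IsManifold 𝓘(ℝ, F) 1 M := .of_le (n := ∞) (by simp)
  filter_upwards [h1, h2] with w' h1 h2 η
  have hcd := h1.mdifferentiableAt one_ne_zero
  have hx := mdifferentiableAt_extChartAt (I := 𝓘(ℝ, F)) h2
  have h3 : (extChartAt 𝓘(ℝ, F) (c w)).symm (extChartAt 𝓘(ℝ, F) (c w) (c w')) = c w' :=
    (extChartAt 𝓘(ℝ, F) (c w)).left_inv (by simpa using h2)
  have h4 := mfderivWithin_extChartAt_symm_comp_mfderiv_extChartAt' (I := 𝓘(ℝ, F))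
    (x := c w) (y := c w') (by simpa using h2)
  simp only [modelWithCornersSelf_coe, range_id, mfderivWithin_univ] at h4
  have h5 : fderiv ℝ (extChartAt 𝓘(ℝ, F) (c w) ∘ c) w' =
      (tder (E := F) (E' := F) (extChartAt 𝓘(ℝ, F) (c w)) (c w')).comp
        (tder (E := W) (E' := F) c w') := by
    rw [← tder_eq_fderiv, ← tder_comp _ hx hcd]
    rfl
  rw [pairing, DiffForm.functional_apply, pullInChart, h5]
  simp only [ContinuousAlternatingMap.compContinuousLinearMap_apply, inChart]
  rw [h3]
  refine congrArg _ (funext fun i => ?_)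
  fin_cases i
  exact (DFunLike.congr_fun h4 (tder (E := W) (E' := F) c w' η)).symm

theorem contDiffAt_pairing {α : DiffForm F M 1} (hα : IsSmoothForm α) {c : W → M} {w : W}
    (hc : ContMDiffAt 𝓘(ℝ, W) 𝓘(ℝ, F) ∞ c w) (η : W) :
    ContDiffAt ℝ ∞ (pairing α c η) w := by
  have h1 := contDiffAt_extChartAt_comp hc
  have h2 : ContDiffAt ℝ ∞ (fun w' => inChart α (c w) (extChartAt 𝓘(ℝ, F) (c w) (c w'))) w :=
    ContDiffAt.comp (g := inChart α (c w)) w (contDiffAt_inChart hα (c w)) h1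
  have h3 : ContDiffAt ℝ ∞ (fun w' =>
      (ContinuousAlternatingMap.ofSubsingletonLIE (𝕜 := ℝ) (E := F) (F := ℝ) (0 : Fin 1)).symm
        (inChart α (c w) (extChartAt 𝓘(ℝ, F) (c w) (c w')))
        (fderiv ℝ (extChartAt 𝓘(ℝ, F) (c w) ∘ c) w' η)) w := by
    refine ContDiffAt.clm_apply (ContDiffAt.comp w ?_ h2) ?_
    · exact (ContinuousAlternatingMap.ofSubsingletonLIE (𝕜 := ℝ) (E := F)
        (F := ℝ) (0 : Fin 1)).symm.contDiff.contDiffAt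
    · exact (h1.fderiv_right (m := ∞) (by simp)).clm_apply contDiffAt_const
  refine h3.congr_of_eventuallyEq ?_
  filter_upwards [pairing_eventuallyEq (α := α) hc] with w' hw'
  rw [hw' η, functional_eq, pullInChart, ContinuousAlternatingMap.compContinuousLinearMap_apply]
  refine congrArg _ (funext fun i => ?_)
  fin_cases i
  rfl

/-- The invariant formula for the exterior derivative, applied to the pull-back of `α`: constant
fields on `W` commute, so no bracket term appears. Naturality of the exterior derivative moves it
back to the manifold. -/
theorem fderiv_pairing_sub {α : DiffForm F M 1} (hα : IsSmoothForm α) {c : W → M} {w : W}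
    (hc : ContMDiffAt 𝓘(ℝ, W) 𝓘(ℝ, F) ∞ c w) (ξ η : W) :
    fderiv ℝ (pairing α c η) w ξ - fderiv ℝ (pairing α c ξ) w η =
      DiffForm.pair (extDer α) (c w) (tder (E := W) (E' := F) c w ξ)
        (tder (E := W) (E' := F) c w η) := by
  have : IsManifold 𝓘(ℝ, F) 1 M := .of_le (n := ∞) (by simp)
  have h1 := contDiffAt_extChartAt_comp hc
  have h0 := contDiffAt_inChart hα (c w)
  have hd : DifferentiableAt ℝ (pullInChart α c w) w := by
    have h2 : DifferentiableAt ℝ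
        (fun w' => inChart α (c w) (extChartAt 𝓘(ℝ, F) (c w) (c w'))) w :=
      DifferentiableAt.comp (g := inChart α (c w)) w (h0.differentiableAt (by simp))
        (h1.differentiableAt (by simp))
    have h3 : DifferentiableAt ℝ (fderiv ℝ (extChartAt 𝓘(ℝ, F) (c w) ∘ c)) w :=
      (h1.fderiv_right (m := ∞) (by simp)).differentiableAt (by simp)
    exact (h2.hasFDerivAt.continuousAlternatingMapCompContinuousLinearMap
      h3.hasFDerivAt).differentiableAt
  have key : extDeriv (pullInChart α c w) w =
      (extDeriv (inChart α (c w)) (extChartAt 𝓘(ℝ, F) (c w) (c w))).compContinuousLinearMap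
        (fderiv ℝ (extChartAt 𝓘(ℝ, F) (c w) ∘ c) w) :=
    extDeriv_pullback (r := ∞) (f := extChartAt 𝓘(ℝ, F) (c w) ∘ c)
      (h0.differentiableAt (by simp)) h1
      (by simp only [minSmoothness_of_isRCLikeNormedField]; exact ENat.LEInfty.out)
  have h5 : fderiv ℝ (extChartAt 𝓘(ℝ, F) (c w) ∘ c) w =
      (tder (E := F) (E' := F) (extChartAt 𝓘(ℝ, F) (c w)) (c w)).comp
        (tder (E := W) (E' := F) c w) := by
    rw [← tder_eq_fderiv, ← tder_comp _ (mdifferentiableAt_extChartAt (by simp))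
      (hc.mdifferentiableAt (by simp))]
    rfl
  have h6 := extDeriv_apply hd ![ξ, η]
  have e1 : ∀ ζ : W, fderiv ℝ (pairing α c ζ) w = fderiv ℝ (fun y => pullInChart α c w y ![ζ]) w :=
    fun ζ => Filter.EventuallyEq.fderiv_eq (by
      filter_upwards [pairing_eventuallyEq (α := α) hc] with w' hw' using hw' ζ)
  have r0 : (0 : Fin 2).removeNth ![ξ, η] = ![η] := by ext i; fin_cases i; rfl
  have r1 : (1 : Fin 2).removeNth ![ξ, η] = ![ξ] := by ext i; fin_cases i; rfl
  rw [Fin.sum_univ_two, r0, r1] at h6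
  simp only [Fin.val_zero, pow_zero, one_smul, Fin.val_one, pow_one, neg_smul,
    Matrix.cons_val_zero, Matrix.cons_val_one] at h6
  rw [e1, e1, sub_eq_add_neg, ← h6, key, h5]
  simp only [ContinuousAlternatingMap.compContinuousLinearMap_apply, DiffForm.pair, extDer]
  refine congrArg _ (funext fun i => ?_)
  fin_cases i <;> rfl

end FormCalculus
-- Multiplying a 1-form by a function
section Rescaling

variable {F : Type*} [NormedAddCommGroup F] [NormedSpace ℝ F]
  {M : Type*} [TopologicalSpace M] [ChartedSpace F M]

theorem DiffForm.functional_smul (g : M → ℝ) (α : DiffForm F M 1) (x : M) :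
    DiffForm.functional (fun y => g y • α y) x = g x • α.functional x :=
  map_smul (ContinuousAlternatingMap.ofSubsingletonLIE (𝕜 := ℝ) (E := F) (F := ℝ)
    (0 : Fin 1)).symm (g x) (α x)

variable [IsManifold 𝓘(ℝ, F) ∞ M]

theorem IsSmoothForm.smul {g : M → ℝ} (hg : ContMDiff 𝓘(ℝ, F) 𝓘(ℝ, ℝ) ∞ g)
    {k : ℕ} {α : DiffForm F M k} (hα : IsSmoothForm α) :
    IsSmoothForm (fun x => g x • α x) := by
  intro x₀
  have h1 : ContDiffOn ℝ ∞ (fun y => g ((extChartAt 𝓘(ℝ, F) x₀).symm y))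
      (extChartAt 𝓘(ℝ, F) x₀).target :=
    (hg.comp_contMDiffOn (contMDiffOn_extChartAt_symm x₀)).contDiffOn
  refine (h1.smul (hα x₀)).congr fun y _ => ?_
  ext v
  rfl

theorem contMDiffAt_extChartAt_symm_self (x : M) :
    ContMDiffAt 𝓘(ℝ, F) 𝓘(ℝ, F) ∞ (extChartAt 𝓘(ℝ, F) x).symm (extChartAt 𝓘(ℝ, F) x x) :=
  (contMDiffOn_extChartAt_symm x).contMDiffAt (extChartAt_target_mem_nhds x)

theorem tder_extChartAt_symm_self (x : M) :
    tder (E := F) (E' := F) (extChartAt 𝓘(ℝ, F) x).symm (extChartAt 𝓘(ℝ, F) x x) =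
      .id ℝ F := by
  have : IsManifold 𝓘(ℝ, F) 1 M := .of_le (n := ∞) (by simp)
  have h := mfderivWithin_range_extChartAt_symm (I := 𝓘(ℝ, F)) (x := x)
  simp only [modelWithCornersSelf_coe, range_id, mfderivWithin_univ] at h
  exact h

/-- The Leibniz rule d(gα) = g dα + dg ∧ α, from the structure equation along the inverse chart,
whose derivative at the base point is the identity. -/
theorem pair_extDer_smul {g : M → ℝ} (hg : ContMDiff 𝓘(ℝ, F) 𝓘(ℝ, ℝ) ∞ g)
    {α : DiffForm F M 1} (hα : IsSmoothForm α) (x : M) (v w : F) :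
    DiffForm.pair (extDer (fun x => g x • α x)) x v w =
      g x * DiffForm.pair (extDer α) x v w +
        (tder (E := F) (E' := ℝ) g x v * α.functional x w -
          tder (E := F) (E' := ℝ) g x w * α.functional x v) := by
  let c : F → M := fun z => (extChartAt 𝓘(ℝ, F) x).symm z
  let y : F := extChartAt 𝓘(ℝ, F) x x
  have hcy : c y = x := extChartAt_to_inv x
  have hcs : ContMDiffAt 𝓘(ℝ, F) 𝓘(ℝ, F) ∞ c y := contMDiffAt_extChartAt_symm_self x
  have hcd : tder (E := F) (E' := F) c y = .id ℝ F := tder_extChartAt_symm_self x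
  have k1 := fderiv_pairing_sub (hα.smul hg) hcs v w
  have k2 := fderiv_pairing_sub hα hcs v w
  have hgd : MDifferentiableAt 𝓘(ℝ, F) 𝓘(ℝ, ℝ) g (c y) := hg.mdifferentiableAt (by simp)
  have hcd' : MDifferentiableAt 𝓘(ℝ, F) 𝓘(ℝ, F) c y := hcs.mdifferentiableAt (by simp)
  have hgc : DifferentiableAt ℝ (fun z => g (c z)) y := (hgd.comp y hcd').differentiableAt
  have hgc' : fderiv ℝ (fun z => g (c z)) y = tder (E := F) (E' := ℝ) g x := by
    rw [← tder_eq_fderiv, tder_comp y hgd hcd', hcd, hcy, ContinuousLinearMap.comp_id]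
  have hp : ∀ η, pairing (fun x => g x • α x) c η = fun z => g (c z) * pairing α c η z := by
    intro η
    ext z
    rw [pairing, DiffForm.functional_smul]
    rfl
  have hpd : ∀ η ξ, fderiv ℝ (pairing (fun x => g x • α x) c η) y ξ =
      g x * fderiv ℝ (pairing α c η) y ξ +
        α.functional x η * tder (E := F) (E' := ℝ) g x ξ := by
    intro η ξ
    have h := (contDiffAt_pairing hα hcs η).differentiableAt (by simp)
    rw [hp η, fderiv_fun_mul hgc h, hgc']
    have : pairing α c η y = α.functional x η := by rw [pairing, hcd, hcy]; rfl
    simp [this, hcy]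
  rw [hpd, hpd, hcd, hcy] at k1
  rw [hcd, hcy] at k2
  simp only [ContinuousLinearMap.id_apply] at k1 k2
  rw [← k1, ← k2]
  ring

end Rescaling

/-! ### Differentiable angles for circle-valued maps -/

section Circle

variable {E : Type*} [NormedAddCommGroup E] [NormedSpace ℝ E]
  {P : Type*} [TopologicalSpace P] [ChartedSpace E P]

theorem Circle.contMDiff_coe : ContMDiff (𝓡 1) 𝓘(ℝ, ℂ) ∞ (fun z : Circle => (z : ℂ)) :=
  have : Fact (Module.finrank ℝ ℂ = 1 + 1) := finrank_real_complex_fact'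
  contMDiff_coe_sphere (E := ℂ) (n := 1)

/-- Near a point of differentiability, a map to the circle is the exponential of a differentiable
angle. -/
theorem exists_angle {h : P → Circle} {p : P} (hh : MDifferentiableAt 𝓘(ℝ, E) (𝓡 1) h p) :
    ∃ θ : P → ℝ, θ p = 0 ∧ MDifferentiableAt 𝓘(ℝ, E) 𝓘(ℝ, ℝ) θ p ∧
      ∀ y, h y = Circle.exp (θ y) * h p := by
  -- Dividing by `h p` moves the value at `p` to 1, away from the branch cut; the exponential
  -- identity holds everywhere, differentiability only at `p`.
  refine ⟨fun y => Complex.arg ((h y / h p : Circle) : ℂ), by simp, ?_, fun y => ?_⟩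
  · have h1 : MDifferentiableAt 𝓘(ℝ, E) 𝓘(ℝ, ℂ) (fun y => (h y : ℂ)) p :=
      (Circle.contMDiff_coe.mdifferentiableAt (by simp)).comp p hh
    have h2 : DifferentiableAt ℝ (fun z : ℂ => Complex.arg (z / (h p : ℂ))) (h p) := by
      have h3 : DifferentiableAt ℝ (fun z : ℂ => Complex.log (z / (h p : ℂ))) (h p) := by
        have h5 : (h p : ℂ) / (h p : ℂ) = 1 := div_self (Circle.coe_ne_zero _)
        refine DifferentiableAt.restrictScalars ℝ (DifferentiableAt.clog ?_ ?_)
        · exact differentiableAt_id.div_const _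
        · rw [h5]; exact Complex.one_mem_slitPlane
      have h6 := DifferentiableAt.comp (h p : ℂ) Complex.imCLM.differentiableAt h3
      simpa only [Function.comp_def, Complex.imCLM_apply, Complex.log_im] using h6
    have h4 := h2.mdifferentiableAt.comp p h1
    refine h4.congr_of_eventuallyEq (Filter.Eventually.of_forall fun y => ?_)
    simp
  · rw [Circle.exp_arg, div_mul_cancel]

end Circle

/-! ### Infinitesimal circle actions -/

section Actions

variable {E : Type*} [NormedAddCommGroup E] [NormedSpace ℝ E]
  {P : Type*} [TopologicalSpace P] [ChartedSpace E P]
  {F : Type*} [NormedAddCommGroup F] [NormedSpace ℝ F]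
  {M : Type*} [TopologicalSpace M] [ChartedSpace F M] [MulAction Circle M]
  [ContMDiffSMul (𝓡 1) 𝓘(ℝ, F) ∞ Circle M]

variable (F) in
/-- The generator of a circle action, with values in the model space. -/
def gen (x : M) : F := generator F x

theorem contMDiff_exp_smul : ContMDiff (𝓘(ℝ, ℝ).prod 𝓘(ℝ, F)) 𝓘(ℝ, F) ∞
    (fun p : ℝ × M => Circle.exp p.1 • p.2) :=
  (contMDiff_circleExp.comp contMDiff_fst).smul contMDiff_snd

theorem contMDiff_orbit (x : M) :
    ContMDiff 𝓘(ℝ, ℝ) 𝓘(ℝ, F) ∞ (fun t : ℝ => Circle.exp t • x) :=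
  contMDiff_circleExp.smul contMDiff_const

theorem contMDiff_smul_left (g : Circle) : ContMDiff 𝓘(ℝ, F) 𝓘(ℝ, F) ∞ (fun x : M => g • x) :=
  ContMDiffSMul.contMDiff_const_smul (I := 𝓡 1) g

theorem tder_orbit (x : M) (t : ℝ) :
    tder (E := ℝ) (E' := F) (fun t : ℝ => Circle.exp t • x) t 1 =
      gen F (Circle.exp t • x) := by
  have h : (fun t' : ℝ => Circle.exp t' • x) =
      fun t' => (fun r : ℝ => Circle.exp r • Circle.exp t • x) (t' - t) := by
    ext t'
    simp only [smul_smul, ← Circle.exp_add, sub_add_cancel]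
  have h2 : DifferentiableAt ℝ (fun t' : ℝ => t' - t) t := by fun_prop
  rw [h, tder_comp (E := ℝ) (E' := ℝ) (E'' := F) (g := fun r : ℝ => Circle.exp r • Circle.exp t • x)
    (f := fun t' : ℝ => t' - t) t
    ((contMDiff_orbit _).mdifferentiableAt (by simp)) h2.mdifferentiableAt, sub_self]
  rw [tder_eq_fderiv]
  simp only [ContinuousLinearMap.comp_apply, fderiv_sub_const, fderiv_fun_id]
  rfl

/-- The product rule for the action map: varying the angle contributes a multiple of the generator,
varying the point contributes the translated derivative. -/
theorem exp_smul_hasDeriv {ρ : P → ℝ} {q : P → M} {p : P}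
    (hρ : MDifferentiableAt 𝓘(ℝ, E) 𝓘(ℝ, ℝ) ρ p) (hq : MDifferentiableAt 𝓘(ℝ, E) 𝓘(ℝ, F) q p) :
    MDifferentiableAt 𝓘(ℝ, E) 𝓘(ℝ, F) (fun y => Circle.exp (ρ y) • q y) p ∧
    ∀ v : E, tder (E := E) (E' := F) (fun y => Circle.exp (ρ y) • q y) p v =
      tder (E := E) (E' := ℝ) ρ p v • gen F (Circle.exp (ρ p) • q p) +
        tder (E := F) (E' := F) (fun x : M => Circle.exp (ρ p) • x) (q p)
          (tder (E := E) (E' := F) q p v) := by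
  have hA : MDifferentiableAt (𝓘(ℝ, ℝ).prod 𝓘(ℝ, F)) 𝓘(ℝ, F)
    (fun p : ℝ × M => Circle.exp p.1 • p.2) (ρ p, q p) :=
    contMDiff_exp_smul.mdifferentiableAt (by simp)
  have hc := hA.hasMFDerivAt.comp p (hρ.hasMFDerivAt.prodMk hq.hasMFDerivAt)
  refine ⟨hc.mdifferentiableAt, fun v => ?_⟩
  have h1 := hc.mfderiv
  have h2 := mfderiv_prod_eq_add_apply hA
    (v := ((tder (E := E) (E' := ℝ) ρ p v, tder (E := E) (E' := F) q p v) : ℝ × F))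
  have h3 := DFunLike.congr_fun h1 v
  refine h3.trans (h2.trans ?_)
  have h4 : tder (E := ℝ) (E' := F) (fun t : ℝ => Circle.exp t • q p) (ρ p)
    (tder (E := E) (E' := ℝ) ρ p v) =
      tder (E := E) (E' := ℝ) ρ p v • gen F (Circle.exp (ρ p) • q p) := by
    rw [← tder_orbit, ← map_smul, smul_eq_mul, mul_one]
  rw [← h4]
  rfl

end Actions

/-! ### Local sections, vertical vectors and lifts in a principal circle bundle -/

section Bundle

variable {E : Type*} [NormedAddCommGroup E] [NormedSpace ℝ E]
  {B : Type*} [TopologicalSpace B] [ChartedSpace E B]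
  {F : Type*} [NormedAddCommGroup F] [NormedSpace ℝ F]
  {M : Type*} [TopologicalSpace M] [ChartedSpace F M] [MulAction Circle M]
  {π : M → B}

/-- `s` is a smooth section of a circle bundle over the open set `U`, and `h` is the corresponding
fibre coordinate. -/
structure IsLocalSection (E F : Type*) [NormedAddCommGroup E] [NormedSpace ℝ E]
    [NormedAddCommGroup F] [NormedSpace ℝ F]
    {B : Type*} [TopologicalSpace B] [ChartedSpace E B]
    {M : Type*} [TopologicalSpace M] [ChartedSpace F M] [MulAction Circle M]
    (π : M → B) (U : Set B) (s : B → M) (h : M → Circle) : Prop where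
  isOpen : IsOpen U
  smooth_section : ContMDiffOn 𝓘(ℝ, E) 𝓘(ℝ, F) ∞ s U
  proj_section : ∀ b ∈ U, π (s b) = b
  smooth_coord : ContMDiffOn 𝓘(ℝ, F) (𝓡 1) ∞ h (π ⁻¹' U)
  coord_smul_section : ∀ x, π x ∈ U → h x • s (π x) = x
  coord_section : ∀ b ∈ U, h (s b) = 1
  coord_smul : ∀ (g : Circle) (x : M), π x ∈ U → h (g • x) = g * h x

theorem IsPrincipalCircleBundle.exists_isLocalSection (hπ : IsPrincipalCircleBundle F E π) (b : B) :
    ∃ (U : Set B) (s : B → M) (h : M → Circle), b ∈ U ∧ IsLocalSection E F π U s h := by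
  obtain ⟨e, hb, he, hes, heq⟩ := hπ.locally_trivial b
  have hsrc : ∀ x, x ∈ e.source ↔ π x ∈ e.baseSet := fun x => by rw [e.source_eq]; rfl
  have htgt : ∀ b ∈ e.baseSet, ∀ g : Circle, (b, g) ∈ e.target := fun b hb g => by
    rw [e.target_eq]; exact ⟨hb, mem_univ _⟩
  have hproj : ∀ b ∈ e.baseSet, π (e.toOpenPartialHomeomorph.symm (b, 1)) = b := fun b hb =>
    e.proj_symm_apply (htgt b hb 1)
  have hright : ∀ b ∈ e.baseSet, e (e.toOpenPartialHomeomorph.symm (b, 1)) = (b, 1) :=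
    fun b hb => e.apply_symm_apply (htgt b hb 1)
  refine ⟨e.baseSet, fun b => e.toOpenPartialHomeomorph.symm (b, 1), fun x => (e x).2, hb,
    e.open_baseSet, ?_, hproj, ?_, fun x hx => ?_, fun b hb => by rw [hright b hb],
    fun g x hx => heq g x ((hsrc x).2 hx)⟩
  · exact hes.comp (contMDiff_id.prodMk contMDiff_const).contMDiffOn
      fun b hb => htgt b hb 1
  · rw [← e.source_eq]
    exact contMDiff_snd.comp_contMDiffOn he
  · have hy := hproj _ hx
    have hgy : π ((e x).2 • e.toOpenPartialHomeomorph.symm (π x, 1)) = π x := by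
      rw [hπ.proj_smul, hy]
    have hysrc : e.toOpenPartialHomeomorph.symm (π x, 1) ∈ e.source := by
      rw [hsrc, hy]; exact hx
    have hgsrc : (e x).2 • e.toOpenPartialHomeomorph.symm (π x, 1) ∈ e.source := by
      rw [hsrc, hgy]; exact hx
    refine e.injOn hgsrc ((hsrc x).2 hx) (Prod.ext ?_ ?_)
    · exact (e.coe_fst hgsrc).trans (hgy.trans (e.coe_fst ((hsrc x).2 hx)).symm)
    · exact (heq _ _ hysrc).trans (by rw [hright _ hx, mul_one]; rfl)

theorem IsPrincipalCircleBundle.exists_smul_eq (hπ : IsPrincipalCircleBundle F E π) {x y : M}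
    (h : π x = π y) : ∃ g : Circle, g • x = y := by
  obtain ⟨U, s, k, hU, hs⟩ := hπ.exists_isLocalSection (π x)
  refine ⟨k y * (k x)⁻¹, ?_⟩
  have h1 := hs.coord_smul_section x hU
  have h2 := hs.coord_smul_section y (h ▸ hU)
  rw [mul_smul, inv_smul_eq_iff.2 h1.symm, h, h2]

theorem IsPrincipalCircleBundle.eq_one_of_smul_eq (hπ : IsPrincipalCircleBundle F E π)
    {g : Circle} {x : M} (h : g • x = x) : g = 1 := by
  obtain ⟨U, s, k, hU, hs⟩ := hπ.exists_isLocalSection (π x)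
  have h1 := hs.coord_smul g x hU
  rw [h] at h1
  simpa using h1.symm

theorem IsPrincipalCircleBundle.surjective (hπ : IsPrincipalCircleBundle F E π) :
    Function.Surjective π := by
  intro b
  obtain ⟨U, s, k, hU, hs⟩ := hπ.exists_isLocalSection b
  exact ⟨s b, hs.proj_section b hU⟩

theorem IsPrincipalCircleBundle.mdifferentiableAt (hπ : IsPrincipalCircleBundle F E π) (x : M) :
    MDifferentiableAt 𝓘(ℝ, F) 𝓘(ℝ, E) π x :=
  hπ.smooth_proj.mdifferentiableAt (by simp)

theorem IsPrincipalCircleBundle.tder_proj_gen (hπ : IsPrincipalCircleBundle F E π) (x : M) :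
    tder (E := F) (E' := E) π x (gen F x) = 0 := by
  have := hπ.smooth_action
  have h1 : tder (E := ℝ) (E' := E) (fun t : ℝ => π (Circle.exp t • x)) 0 = 0 := by
    simp only [hπ.proj_smul]
    exact tder_const _ _
  rw [tder_comp (E' := F) (f := fun t : ℝ => Circle.exp t • x) 0 (hπ.mdifferentiableAt _)
    ((contMDiff_orbit x).mdifferentiableAt (by simp))] at h1
  have h2 := DFunLike.congr_fun h1 (1 : ℝ)
  rw [ContinuousLinearMap.comp_apply, tder_orbit] at h2
  simpa using h2

theorem IsLocalSection.mdifferentiableAt {U : Set B} {s : B → M} {h : M → Circle}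
    (hs : IsLocalSection E F π U s h) {b : B} (hb : b ∈ U) :
    MDifferentiableAt 𝓘(ℝ, E) 𝓘(ℝ, F) s b :=
  (hs.smooth_section.contMDiffAt (hs.isOpen.mem_nhds hb)).mdifferentiableAt (by simp)

theorem IsLocalSection.mdifferentiableAt_coord {U : Set B} {s : B → M} {h : M → Circle}
    (hs : IsLocalSection E F π U s h) (hπ : IsPrincipalCircleBundle F E π)
    {x : M} (hx : π x ∈ U) :
    MDifferentiableAt 𝓘(ℝ, F) (𝓡 1) h x :=
  (hs.smooth_coord.contMDiffAt ((hs.isOpen.preimage hπ.smooth_proj.continuous).mem_nhds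
    hx)).mdifferentiableAt (by simp)

theorem IsLocalSection.tder_proj_section {U : Set B} {s : B → M} {h : M → Circle}
    (hs : IsLocalSection E F π U s h) (hπ : IsPrincipalCircleBundle F E π)
    {b : B} (hb : b ∈ U) (w : E) :
    tder (E := F) (E' := E) π (s b) (tder (E := E) (E' := F) s b w) = w := by
  have h1 : tder (E := E) (E' := E) (fun b => π (s b)) b = .id ℝ E := by
    rw [← tder_id b]
    refine tder_congr ?_
    filter_upwards [hs.isOpen.mem_nhds hb] with b hb using hs.proj_section b hb
  rw [tder_comp (E' := F) b (hπ.mdifferentiableAt _) (hs.mdifferentiableAt hb)] at h1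
  exact DFunLike.congr_fun h1 w

theorem IsPrincipalCircleBundle.tder_proj_smul (hπ : IsPrincipalCircleBundle F E π)
    (g : Circle) (x : M) (v : F) :
    tder (E := F) (E' := E) π (g • x) (tder (E := F) (E' := F) (fun y : M => g • y) x v) =
      tder (E := F) (E' := E) π x v := by
  have := hπ.smooth_action
  have h1 := tder_comp (E := F) (E' := F) (E'' := E) (g := π) (f := fun y : M => g • y) x
    (hπ.mdifferentiableAt _) ((contMDiff_smul_left g).mdifferentiableAt (by simp))
  simp only [hπ.proj_smul] at h1
  exact (DFunLike.congr_fun h1 v).symm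

theorem IsPrincipalCircleBundle.exists_tder_proj_eq (hπ : IsPrincipalCircleBundle F E π)
    (x : M) (w : E) : ∃ v : F, tder (E := F) (E' := E) π x v = w := by
  obtain ⟨U, s, k, hU, hs⟩ := hπ.exists_isLocalSection (π x)
  refine ⟨tder (E := F) (E' := F) (fun y : M => k x • y) (s (π x))
    (tder (E := E) (E' := F) s (π x) w), ?_⟩
  have h1 := hπ.tder_proj_smul (k x) (s (π x)) (tder (E := E) (E' := F) s (π x) w)
  rw [hs.tder_proj_section hπ hU, hs.coord_smul_section x hU] at h1
  exact h1

/-- Differentiate `y = k y • s (π y)` along `v`: the part passing through `π` dies, and only the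
motion of the angle of `k` remains. -/
theorem IsPrincipalCircleBundle.exists_eq_smul_gen (hπ : IsPrincipalCircleBundle F E π)
    {x : M} {v : F} (hv : tder (E := F) (E' := E) π x v = 0) : ∃ a : ℝ, v = a • gen F x := by
  have := hπ.smooth_action
  obtain ⟨U, s, k, hU, hs⟩ := hπ.exists_isLocalSection (π x)
  obtain ⟨θ, hθ0, hθ, hk⟩ := exists_angle (hs.mdifferentiableAt_coord hπ hU)
  have hsd : MDifferentiableAt 𝓘(ℝ, F) 𝓘(ℝ, F) (fun y => s (π y)) x :=
    (hs.mdifferentiableAt hU).comp x (hπ.mdifferentiableAt x)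
  have hq : MDifferentiableAt 𝓘(ℝ, F) 𝓘(ℝ, F) (fun y => k x • s (π y)) x :=
    ((contMDiff_smul_left (k x)).mdifferentiableAt (by simp)).comp x hsd
  have h0 : tder (E := F) (E' := F) (fun y => k x • s (π y)) x v = 0 := by
    rw [tder_comp (E' := F) (g := fun y : M => k x • y) x
      ((contMDiff_smul_left (k x)).mdifferentiableAt (by simp)) hsd,
      tder_comp (E' := E) x (hs.mdifferentiableAt hU) (hπ.mdifferentiableAt x)]
    simp [hv]
  have h1 := (exp_smul_hasDeriv hθ hq).2 v
  rw [h0, map_zero, add_zero, hθ0, Circle.exp_zero, one_smul, hs.coord_smul_section x hU] at h1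
  have h2 : (fun y => Circle.exp (θ y) • k x • s (π y)) =ᶠ[𝓝 x] fun y => y := by
    filter_upwards [(hs.isOpen.preimage hπ.smooth_proj.continuous).mem_nhds hU] with y hy
    rw [smul_smul, ← hk, hs.coord_smul_section y hy]
  rw [tder_congr h2, tder_id] at h1
  exact ⟨_, h1⟩

end Bundle

/-! ### Connection forms on derivatives of rotated maps -/

section Connection

variable {E : Type*} [NormedAddCommGroup E] [NormedSpace ℝ E]
  {B : Type*} [TopologicalSpace B] [ChartedSpace E B]
  {F : Type*} [NormedAddCommGroup F] [NormedSpace ℝ F]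
  {M : Type*} [TopologicalSpace M] [ChartedSpace F M] [MulAction Circle M]
  {P : Type*} [TopologicalSpace P] {E₀ : Type*} [NormedAddCommGroup E₀] [NormedSpace ℝ E₀]
  [ChartedSpace E₀ P]
  {π : M → B} {σ : DiffForm E B 2} {α : DiffForm F M 1}

theorem IsConnectionForm.functional_gen (hα : IsConnectionForm π σ α) (x : M) :
    α.functional x (gen F x) = 1 :=
  (α.functional_apply x _).trans (hα.normalised x)

theorem IsConnectionForm.functional_smul (hα : IsConnectionForm π σ α) (g : Circle) (x : M)
    (v : F) : α.functional (g • x) (tder (E := F) (E' := F) (fun y : M => g • y) x v) =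
      α.functional x v := by
  have h1 := congrFun (hα.invariant g) x
  rw [α.functional_apply, α.functional_apply, ← h1]
  simp only [pullback, ContinuousAlternatingMap.compContinuousLinearMap_apply]
  refine congrArg _ (funext fun i => ?_)
  fin_cases i
  rfl

theorem IsConnectionForm.pair_extDer (hα : IsConnectionForm π σ α) (x : M) (v w : F) :
    DiffForm.pair (extDer α) x v w =
      σ.pair (π x) (tder (E := F) (E' := E) π x v) (tder (E := F) (E' := E) π x w) := by
  rw [DiffForm.pair, hα.curvature]
  simp only [pullback, ContinuousAlternatingMap.compContinuousLinearMap_apply]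
  refine congrArg _ (funext fun i => ?_)
  fin_cases i <;> rfl

variable [ContMDiffSMul (𝓡 1) 𝓘(ℝ, F) ∞ Circle M]

theorem IsConnectionForm.functional_exp_smul (hα : IsConnectionForm π σ α)
    {ρ : P → ℝ} {q : P → M} {p : P}
    (hρ : MDifferentiableAt 𝓘(ℝ, E₀) 𝓘(ℝ, ℝ) ρ p) (hq : MDifferentiableAt 𝓘(ℝ, E₀) 𝓘(ℝ, F) q p)
    (v : E₀) :
    α.functional (Circle.exp (ρ p) • q p)
      (tder (E := E₀) (E' := F) (fun y => Circle.exp (ρ y) • q y) p v) =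
      tder (E := E₀) (E' := ℝ) ρ p v +
        α.functional (q p) (tder (E := E₀) (E' := F) q p v) := by
  rw [(exp_smul_hasDeriv hρ hq).2, map_add, map_smul, hα.functional_gen, hα.functional_smul]
  simp

/-- The gauge term `l` is the derivative of the angle of `h`, so it does not depend on `q`. Two maps
rotated by the same `h` can therefore be compared without computing it. -/
theorem IsConnectionForm.exists_functional_smul_eq (hα : IsConnectionForm π σ α)
    {h : P → Circle} {p : P} (hh : MDifferentiableAt 𝓘(ℝ, E₀) (𝓡 1) h p) :
    ∃ l : E₀ →L[ℝ] ℝ, ∀ q : P → M, MDifferentiableAt 𝓘(ℝ, E₀) 𝓘(ℝ, F) q p →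
      MDifferentiableAt 𝓘(ℝ, E₀) 𝓘(ℝ, F) (fun y => h y • q y) p ∧
      ∀ v, α.functional (h p • q p)
        (tder (E := E₀) (E' := F) (fun y => h y • q y) p v) =
        l v + α.functional (q p) (tder (E := E₀) (E' := F) q p v) := by
  obtain ⟨θ, hθ0, hθ, hk⟩ := exists_angle hh
  refine ⟨tder (E := E₀) (E' := ℝ) θ p, fun q hq => ?_⟩
  have hd := (contMDiff_smul_left (F := F) (M := M) (h p)).mdifferentiableAt (x := q p) (by simp)
  have hq' : MDifferentiableAt 𝓘(ℝ, E₀) 𝓘(ℝ, F) (fun y => h p • q y) p := hd.comp p hq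
  have he : (fun y => h y • q y) = fun y => Circle.exp (θ y) • h p • q y := by
    ext y
    rw [smul_smul, ← hk]
  rw [he]
  refine ⟨(exp_smul_hasDeriv hθ hq').1, fun v => ?_⟩
  have h1 := hα.functional_exp_smul hθ hq' v
  rw [hθ0, Circle.exp_zero, one_smul] at h1
  rw [h1, tder_comp (E' := F) (g := fun y : M => h p • y) p hd hq, ContinuousLinearMap.comp_apply,
    hα.functional_smul]

end Connection

/-! ### Smooth vector fields, integral curves and fixed points -/

section Fields

variable {F : Type*} [NormedAddCommGroup F] [NormedSpace ℝ F]
  {M : Type*} [TopologicalSpace M] [ChartedSpace F M]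

theorem tangentBundle_mk_eq {x y : M} (h : x = y) {v w : F} (hv : v = w) :
    (⟨x, v⟩ : TangentBundle 𝓘(ℝ, F) M) = ⟨y, w⟩ := by
  subst h hv
  rfl

/-- The velocity field at time `0` of a smooth family of curves is smooth. -/
theorem contMDiffAt_velocity [IsManifold 𝓘(ℝ, F) 1 M] {f : ℝ × M → M} {O : Set (ℝ × M)}
    (hO : IsOpen O) (hf : ContMDiffOn (𝓘(ℝ, ℝ).prod 𝓘(ℝ, F)) 𝓘(ℝ, F) ∞ f O) {x₀ : M}
    (hx₀ : ((0 : ℝ), x₀) ∈ O) (h0 : ∀ᶠ x in 𝓝 x₀, f (0, x) = x)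
    {Y : M → F}
    (hY : ∀ᶠ x in 𝓝 x₀, Y x = tder (E := ℝ) (E' := F) (fun t : ℝ => f (t, x)) 0 1) :
    ContMDiffAt 𝓘(ℝ, F) 𝓘(ℝ, F).tangent ∞
      (fun x => (⟨x, Y x⟩ : TangentBundle 𝓘(ℝ, F) M)) x₀ := by
  have h1 := hf.contMDiffOn_tangentMapWithin (m := ∞) (by simp) hO.uniqueMDiffOn
  -- The velocity field is the tangent map of `f` applied to this smooth section, the unit time
  -- vector at `(0, x)`.
  let S : M → TangentBundle (𝓘(ℝ, ℝ).prod 𝓘(ℝ, F)) (ℝ × M) := fun x =>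
    (equivTangentBundleProd 𝓘(ℝ, ℝ) ℝ 𝓘(ℝ, F) M).symm
      ((⟨0, (1 : ℝ)⟩ : TangentBundle 𝓘(ℝ, ℝ) ℝ),
        Bundle.zeroSection F (TangentSpace 𝓘(ℝ, F) : M → Type _) x)
  have hS : ContMDiff 𝓘(ℝ, F) (𝓘(ℝ, ℝ).prod 𝓘(ℝ, F)).tangent ∞ S := by
    refine contMDiff_equivTangentBundleProd_symm.comp ?_
    exact contMDiff_const.prodMk (Bundle.contMDiff_zeroSection ℝ _)
  have hSp : ∀ x, S x = ⟨((0 : ℝ), x), (((1 : ℝ), (0 : F)) : ℝ × F)⟩ := fun x => rfl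
  have hmem : S x₀ ∈ Bundle.TotalSpace.proj ⁻¹' O := by rw [hSp]; exact hx₀
  have h2 : ContMDiffAt 𝓘(ℝ, F) 𝓘(ℝ, F).tangent ∞
      (fun x => tangentMapWithin (𝓘(ℝ, ℝ).prod 𝓘(ℝ, F)) 𝓘(ℝ, F) f O (S x)) x₀ := by
    refine (h1.contMDiffAt ?_).comp x₀ hS.contMDiffAt
    exact (hO.preimage (FiberBundle.continuous_proj _ _)).mem_nhds hmem
  refine h2.congr_of_eventuallyEq ?_
  have hOx : ∀ᶠ x in 𝓝 x₀, ((0 : ℝ), x) ∈ O :=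
    (hO.preimage (by fun_prop : Continuous fun x : M => ((0 : ℝ), x))).mem_nhds hx₀
  filter_upwards [h0, hY, hOx] with x h0 hY hOx
  rw [hSp, hY]
  refine (tangentBundle_mk_eq h0 ?_).symm
  have hfd : MDifferentiableAt (𝓘(ℝ, ℝ).prod 𝓘(ℝ, F)) 𝓘(ℝ, F) f (0, x) :=
    (hf.contMDiffAt (hO.mem_nhds hOx)).mdifferentiableAt (by simp)
  have h3 := mfderiv_prod_eq_add_apply hfd (v := (((1 : ℝ), (0 : F)) : ℝ × F))
  have h4 := DFunLike.congr_fun (mfderivWithin_of_isOpen (I := 𝓘(ℝ, ℝ).prod 𝓘(ℝ, F))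
    (I' := 𝓘(ℝ, F)) (f := f) hO hOx) (((1 : ℝ), (0 : F)) : ℝ × F)
  refine h4.trans (h3.trans ?_)
  have h5 : tder (E := F) (E' := F) (fun z : M => f (0, z)) x 0 = 0 := map_zero _
  exact (congrArg (fun z : F => tder (E := ℝ) (E' := F) (fun t : ℝ => f (t, x)) 0 1 + z) h5).trans
    (add_zero _)

theorem isSmoothField_generator [IsManifold 𝓘(ℝ, F) 1 M] [MulAction Circle M]
    [ContMDiffSMul (𝓡 1) 𝓘(ℝ, F) ∞ Circle M] :
    IsSmoothField (E := F) (M := M) (fun x => generator F x) := fun x₀ =>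
  contMDiffAt_velocity (f := fun p : ℝ × M => Circle.exp p.1 • p.2) isOpen_univ
    contMDiff_exp_smul.contMDiffOn (mem_univ _) (by simp)
    (Filter.Eventually.of_forall fun _ => rfl)

theorem isMIntegralCurve_of_tder {γ : ℝ → M} {R : M → F}
    (hγ : MDifferentiable 𝓘(ℝ, ℝ) 𝓘(ℝ, F) γ)
    (h : ∀ t, tder (E := ℝ) (E' := F) γ t 1 = R (γ t)) :
    IsMIntegralCurve (I := 𝓘(ℝ, F)) γ R := by
  intro t
  refine (congrArg (HasMFDerivAt 𝓘(ℝ, ℝ) 𝓘(ℝ, F) γ t) ?_).mp (hγ t).hasMFDerivAt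
  refine ContinuousLinearMap.ext_ring ?_
  exact (h t).trans (one_smul ℝ (R (γ t))).symm

theorem isMIntegralCurve_orbit [MulAction Circle M]
    [ContMDiffSMul (𝓡 1) 𝓘(ℝ, F) ∞ Circle M] (x : M) :
    IsMIntegralCurve (I := 𝓘(ℝ, F)) (fun t : ℝ => Circle.exp t • x) (gen F) :=
  isMIntegralCurve_of_tder ((contMDiff_orbit x).mdifferentiable (by simp)) (tder_orbit x)

theorem IsMIntegralCurve.tder_eq {γ : ℝ → M} {R : M → F}
    (h : IsMIntegralCurve (I := 𝓘(ℝ, F)) γ R) (t : ℝ) :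
    tder (E := ℝ) (E' := F) γ t 1 = R (γ t) := by
  have h1 := DFunLike.congr_fun (h t).mfderiv (1 : ℝ)
  exact h1.trans (one_smul ℝ (R (γ t)))

/-- At a zero of the generator the constant curve and the orbit are integral curves with the same
start, hence equal. -/
theorem mem_fixedPoints_iff_gen [IsManifold 𝓘(ℝ, F) 1 M] [T2Space M] [MulAction Circle M]
    [ContMDiffSMul (𝓡 1) 𝓘(ℝ, F) ∞ Circle M] {x : M} :
    x ∈ MulAction.fixedPoints Circle M ↔ gen F x = 0 := by
  constructor
  · intro hx
    have h : (fun t : ℝ => Circle.exp t • x) = fun _ => x := funext fun t => hx _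
    have h2 : gen F x = tder (E := ℝ) (E' := F) (fun t : ℝ => Circle.exp t • x) 0 1 := rfl
    rw [h2, h, tder_const]
    rfl
  · intro hx g
    have h1 : IsMIntegralCurve (I := 𝓘(ℝ, F)) (fun _ : ℝ => x) (gen F) :=
      isMIntegralCurve_of_tder (fun _ => mdifferentiableAt_const) fun t => by
        rw [tder_const, hx]; rfl
    have h2 := isMIntegralCurve_Ioo_eq_of_contMDiff_boundaryless (t₀ := 0)
      ((isSmoothField_generator (F := F) (M := M)).of_le (by simp))
      (isMIntegralCurve_orbit x) h1 (by simp)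
    obtain ⟨t, rfl⟩ := Circle.exp_surjective g
    exact congrFun h2 t

end Fields

/-! ### Hamiltonian circle actions and their flow in a chart -/

section Hamiltonian

variable {E : Type*} [NormedAddCommGroup E] [NormedSpace ℝ E]
  {B : Type*} [TopologicalSpace B] [ChartedSpace E B] [MulAction Circle B]
  {σ : DiffForm E B 2} {H : B → ℝ}

theorem IsHamiltonianCircleAction.pair_gen (hH : IsHamiltonianCircleAction σ H) (b : B) (v : E) :
    σ.pair b (gen E b) v = -tder (E := E) (E' := ℝ) H b v :=
  hH.hamiltonian b v

omit [MulAction Circle B] in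
theorem DiffForm.pair_self (β : DiffForm E B 2) (b : B) (v : E) : β.pair b v v = 0 :=
  (β b).map_eq_zero_of_eq ![v, v] (i := 0) (j := 1) rfl (by decide)

theorem IsHamiltonianCircleAction.tder_gen (hH : IsHamiltonianCircleAction σ H) (b : B) :
    tder (E := E) (E' := ℝ) H b (gen E b) = 0 := by
  have h := hH.pair_gen b (gen E b)
  rw [DiffForm.pair_self] at h
  linarith

theorem IsHamiltonianCircleAction.mdifferentiableAt (hH : IsHamiltonianCircleAction σ H) (b : B) :
    MDifferentiableAt 𝓘(ℝ, E) 𝓘(ℝ, ℝ) H b :=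
  hH.smooth.mdifferentiableAt (by simp)

theorem IsHamiltonianCircleAction.add_const (hH : IsHamiltonianCircleAction σ H) (c : ℝ) :
    IsHamiltonianCircleAction σ (fun b => H b + c) where
  smooth_action := hH.smooth_action
  smooth := by
    have h : ContDiff ℝ ∞ (fun r : ℝ => r + c) := contDiff_id.add contDiff_const
    exact h.contMDiff.comp hH.smooth
  hamiltonian b v := by
    rw [hH.hamiltonian]
    have h : tder (E := E) (E' := ℝ) (fun b => H b + c) b = tder (E := E) (E' := ℝ) H b := by
      have hd : DifferentiableAt ℝ (fun r : ℝ => r + c) (H b) := by fun_prop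
      rw [tder_comp (E' := ℝ) (g := fun r : ℝ => r + c) b hd.mdifferentiableAt
        (hH.mdifferentiableAt b), tder_eq_fderiv, fderiv_add_const, fderiv_fun_id]
      rfl
    exact congrArg Neg.neg (DFunLike.congr_fun h v).symm

/-- The flow of the circle action in the chart around `b₀`. -/
def orbitMap (E : Type*) [NormedAddCommGroup E] [NormedSpace ℝ E]
    {B : Type*} [TopologicalSpace B] [ChartedSpace E B] [MulAction Circle B] (b₀ : B) :
    ℝ × E → B :=
  fun p => Circle.exp p.1 • (extChartAt 𝓘(ℝ, E) b₀).symm p.2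

variable [IsManifold 𝓘(ℝ, E) ∞ B]

theorem contMDiffAt_orbitMap [ContMDiffSMul (𝓡 1) 𝓘(ℝ, E) ∞ Circle B] {b₀ : B} {p : ℝ × E}
    (hp : p.2 ∈ (extChartAt 𝓘(ℝ, E) b₀).target) :
    ContMDiffAt 𝓘(ℝ, ℝ × E) 𝓘(ℝ, E) ∞ (orbitMap E b₀) p := by
  have h1 : ContMDiffAt 𝓘(ℝ, ℝ × E) 𝓘(ℝ, ℝ) ∞ (Prod.fst : ℝ × E → ℝ) p :=
    contDiff_fst.contMDiff.contMDiffAt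
  have h2 : ContMDiffAt 𝓘(ℝ, ℝ × E) 𝓘(ℝ, E) ∞ (Prod.snd : ℝ × E → E) p :=
    contDiff_snd.contMDiff.contMDiffAt
  have h3 : ContMDiffAt 𝓘(ℝ, E) 𝓘(ℝ, E) ∞ (extChartAt 𝓘(ℝ, E) b₀).symm p.2 :=
    (contMDiffOn_extChartAt_symm b₀).contMDiffAt ((isOpen_extChartAt_target b₀).mem_nhds hp)
  exact ((contMDiff_circleExp.contMDiffAt).comp p h1).smul (h3.comp p h2)

theorem tder_orbitMap_time [ContMDiffSMul (𝓡 1) 𝓘(ℝ, E) ∞ Circle B] {b₀ : B} {p : ℝ × E}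
    (hp : p.2 ∈ (extChartAt 𝓘(ℝ, E) b₀).target) :
    tder (E := ℝ × E) (E' := E) (orbitMap E b₀) p (1, 0) = gen E (orbitMap E b₀ p) := by
  have hd : HasFDerivAt (fun t : ℝ => (t, p.2)) (ContinuousLinearMap.inl ℝ ℝ E) p.1 :=
    hasFDerivAt_prodMk_left p.1 p.2
  have h1 := tder_comp (E := ℝ) (E' := ℝ × E) (E'' := E) (g := orbitMap E b₀)
    (f := fun t : ℝ => (t, p.2)) p.1
    ((contMDiffAt_orbitMap (p := (p.1, p.2)) hp).mdifferentiableAt (by simp))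
    hd.differentiableAt.mdifferentiableAt
  have h2 := tder_orbit (F := E) ((extChartAt 𝓘(ℝ, E) b₀).symm p.2) p.1
  rw [tder_eq_fderiv, hd.fderiv] at h1
  have h3 := DFunLike.congr_fun h1 (1 : ℝ)
  exact h3.symm.trans h2

end Hamiltonian

/-! ### The lift of the generator with prescribed connection value -/

section Reeb

variable {E : Type*} [NormedAddCommGroup E] [NormedSpace ℝ E]
  {B : Type*} [TopologicalSpace B] [ChartedSpace E B] [MulAction Circle B]
  {F : Type*} [NormedAddCommGroup F] [NormedSpace ℝ F]
  {M : Type*} [TopologicalSpace M] [ChartedSpace F M] [MulAction Circle M]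
  {σ : DiffForm E B 2} {H : B → ℝ} {π : M → B} {α : DiffForm F M 1}

/-- A Boothby–Wang bundle over a symplectic manifold with a Hamiltonian circle action. -/
structure IsHamiltonianBoothbyWang (σ : DiffForm E B 2) (H : B → ℝ) (π : M → B)
    (α : DiffForm F M 1) : Prop where
  symplectic : IsSymplecticForm σ
  hamiltonian : IsHamiltonianCircleAction σ H
  bundle : IsPrincipalCircleBundle F E π
  connection : IsConnectionForm π σ α

/-- The lift of the generator of the circle action on the base on which the connection form
takes the value of the Hamiltonian. -/
def liftField (E : Type*) [NormedAddCommGroup E] [NormedSpace ℝ E]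
    {B : Type*} [TopologicalSpace B] [ChartedSpace E B] [MulAction Circle B]
    {F : Type*} [NormedAddCommGroup F] [NormedSpace ℝ F]
    {M : Type*} [TopologicalSpace M] [ChartedSpace F M]
    (H : B → ℝ) (π : M → B) (α : DiffForm F M 1) (x : M) : F :=
  Classical.epsilon fun v : F =>
    tder (E := F) (E' := E) π x v = gen E (π x) ∧ α.functional x v = H (π x)

/-- The value of a connection form on the derivative of a section along the generator. -/
def sectionRate (E : Type*) [NormedAddCommGroup E] [NormedSpace ℝ E]
    {B : Type*} [TopologicalSpace B] [ChartedSpace E B] [MulAction Circle B]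
    {F : Type*} [NormedAddCommGroup F] [NormedSpace ℝ F]
    {M : Type*} [TopologicalSpace M] [ChartedSpace F M]
    (α : DiffForm F M 1) (s : B → M) (b : B) : ℝ :=
  α.functional (s b) (tder (E := E) (E' := F) s b (gen E b))

namespace IsHamiltonianBoothbyWang

/-- The difference is vertical, hence a multiple of the generator, and the connection form reads off
the multiple. Together with `exists_lift` this characterises the lifted field. -/
theorem eq_of_proj_of_functional (h : IsHamiltonianBoothbyWang σ H π α) {x : M} {v w : F}
    (h1 : tder (E := F) (E' := E) π x v = tder (E := F) (E' := E) π x w)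
    (h2 : α.functional x v = α.functional x w) : v = w := by
  obtain ⟨a, ha⟩ := h.bundle.exists_eq_smul_gen (x := x) (v := v - w) (by rw [map_sub, h1, sub_self])
  have h3 : α.functional x (v - w) = 0 := by rw [map_sub, h2, sub_self]
  rw [ha, map_smul, h.connection.functional_gen, smul_eq_mul, mul_one] at h3
  rw [h3, zero_smul] at ha
  exact sub_eq_zero.1 ha

theorem exists_lift (h : IsHamiltonianBoothbyWang σ H π α) (x : M) (w : E) (a : ℝ) :
    ∃ v : F, tder (E := F) (E' := E) π x v = w ∧ α.functional x v = a := by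
  obtain ⟨v, hv⟩ := h.bundle.exists_tder_proj_eq x w
  refine ⟨v + (a - α.functional x v) • gen F x, ?_, ?_⟩
  · rw [map_add, map_smul, h.bundle.tder_proj_gen, smul_zero, add_zero, hv]
  · rw [map_add, map_smul, h.connection.functional_gen]
    simp

theorem liftField_spec (h : IsHamiltonianBoothbyWang σ H π α) (x : M) :
    tder (E := F) (E' := E) π x (liftField E H π α x) = gen E (π x) ∧
      α.functional x (liftField E H π α x) = H (π x) :=
  Classical.epsilon_spec (h.exists_lift x (gen E (π x)) (H (π x)))

theorem eq_liftField (h : IsHamiltonianBoothbyWang σ H π α) {x : M} {v : F}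
    (h1 : tder (E := F) (E' := E) π x v = gen E (π x)) (h2 : α.functional x v = H (π x)) :
    v = liftField E H π α x :=
  h.eq_of_proj_of_functional (h1.trans (h.liftField_spec x).1.symm)
    (h2.trans (h.liftField_spec x).2.symm)

variable [IsManifold 𝓘(ℝ, E) ∞ B] [IsManifold 𝓘(ℝ, F) ∞ M]

omit [IsManifold 𝓘(ℝ, E) ∞ B] [IsManifold 𝓘(ℝ, F) ∞ M] in
-- Such a curve is tangent to the lifted field exactly when `deriv ρ t` makes up the difference
-- between the Hamiltonian and `sectionRate`; this dictates both the frozen rate used for smoothness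
-- and the integral in `liftAngle`.
theorem lift_curve (h : IsHamiltonianBoothbyWang σ H π α) {U : Set B} {s : B → M} {k : M → Circle}
    (hs : IsLocalSection E F π U s k) (g : Circle) {b : B} {ρ : ℝ → ℝ} {t : ℝ} (ht : Circle.exp t • b ∈ U)
    (hρ : DifferentiableAt ℝ ρ t) :
    MDifferentiableAt 𝓘(ℝ, ℝ) 𝓘(ℝ, F)
      (fun t : ℝ => Circle.exp (ρ t) • g • s (Circle.exp t • b)) t ∧
    tder (E := F) (E' := E) π (Circle.exp (ρ t) • g • s (Circle.exp t • b))
      (tder (E := ℝ) (E' := F) (fun t : ℝ => Circle.exp (ρ t) • g • s (Circle.exp t • b)) t 1) =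
      gen E (Circle.exp t • b) ∧
    α.functional (Circle.exp (ρ t) • g • s (Circle.exp t • b))
      (tder (E := ℝ) (E' := F) (fun t : ℝ => Circle.exp (ρ t) • g • s (Circle.exp t • b)) t 1) =
      deriv ρ t + sectionRate E α s (Circle.exp t • b) := by
  have := h.bundle.smooth_action
  have := h.hamiltonian.smooth_action
  have hc : MDifferentiableAt 𝓘(ℝ, ℝ) 𝓘(ℝ, E) (fun t : ℝ => Circle.exp t • b) t :=
    (contMDiff_orbit b).mdifferentiableAt (by simp)
  have hsc : MDifferentiableAt 𝓘(ℝ, ℝ) 𝓘(ℝ, F) (fun t : ℝ => s (Circle.exp t • b)) t :=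
    (hs.mdifferentiableAt ht).comp t hc
  have hg : MDifferentiableAt 𝓘(ℝ, F) 𝓘(ℝ, F) (fun x : M => g • x) (s (Circle.exp t • b)) :=
    (contMDiff_smul_left g).mdifferentiableAt (by simp)
  have hq : MDifferentiableAt 𝓘(ℝ, ℝ) 𝓘(ℝ, F) (fun t : ℝ => g • s (Circle.exp t • b)) t :=
    hg.comp t hsc
  have hd := (exp_smul_hasDeriv hρ.mdifferentiableAt hq).1
  refine ⟨hd, ?_, ?_⟩
  · have h1 : (fun t : ℝ => π (Circle.exp (ρ t) • g • s (Circle.exp t • b))) =ᶠ[𝓝 t]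
        fun t : ℝ => Circle.exp t • b := by
      have : ∀ᶠ t' in 𝓝 t, Circle.exp t' • b ∈ U :=
        (contMDiff_orbit (F := E) b).continuous.continuousAt.eventually_mem (hs.isOpen.mem_nhds ht)
      filter_upwards [this] with t' ht'
      rw [h.bundle.proj_smul, h.bundle.proj_smul, hs.proj_section _ ht']
    rw [← tder_orbit, ← tder_congr h1,
      tder_comp (E' := F) (f := fun t : ℝ => Circle.exp (ρ t) • g • s (Circle.exp t • b)) t
        (h.bundle.mdifferentiableAt _) hd]
    rfl
  · rw [h.connection.functional_exp_smul hρ.mdifferentiableAt hq,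
      tder_comp (E' := F) (g := fun x : M => g • x) t hg hsc, ContinuousLinearMap.comp_apply,
      h.connection.functional_smul, tder_comp (E' := E) t (hs.mdifferentiableAt ht) hc,
      ContinuousLinearMap.comp_apply, tder_orbit, tder_eq_fderiv, fderiv_apply_one_eq_deriv]
    rfl

omit [IsManifold 𝓘(ℝ, F) ∞ M] in
theorem contMDiffAt_section_orbitMap (h : IsHamiltonianBoothbyWang σ H π α)
    {U : Set B} {s : B → M} {k : M → Circle} (hs : IsLocalSection E F π U s k) {b₀ : B} {p : ℝ × E}
    (hp : p.2 ∈ (extChartAt 𝓘(ℝ, E) b₀).target) (hpU : orbitMap E b₀ p ∈ U) :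
    ContMDiffAt 𝓘(ℝ, ℝ × E) 𝓘(ℝ, F) ∞ (fun p => s (orbitMap E b₀ p)) p := by
  have := h.hamiltonian.smooth_action
  exact (hs.smooth_section.contMDiffAt (hs.isOpen.mem_nhds hpU)).comp p (contMDiffAt_orbitMap hp)

omit [IsManifold 𝓘(ℝ, F) ∞ M] in
theorem tder_section_orbitMap (h : IsHamiltonianBoothbyWang σ H π α)
    {U : Set B} {s : B → M} {k : M → Circle} (hs : IsLocalSection E F π U s k) {b₀ : B} {p : ℝ × E}
    (hp : p.2 ∈ (extChartAt 𝓘(ℝ, E) b₀).target) (hpU : orbitMap E b₀ p ∈ U) :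
    tder (E := ℝ × E) (E' := F) (fun p => s (orbitMap E b₀ p)) p =
      (tder (E := E) (E' := F) s (orbitMap E b₀ p)).comp
        (tder (E := ℝ × E) (E' := E) (orbitMap E b₀) p) := by
  have := h.hamiltonian.smooth_action
  exact tder_comp p (hs.mdifferentiableAt hpU)
    ((contMDiffAt_orbitMap hp).mdifferentiableAt (by simp))

omit [IsManifold 𝓘(ℝ, F) ∞ M] in
theorem pairing_section_orbitMap (h : IsHamiltonianBoothbyWang σ H π α)
    {U : Set B} {s : B → M} {k : M → Circle} (hs : IsLocalSection E F π U s k) {b₀ : B} {p : ℝ × E}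
    (hp : p.2 ∈ (extChartAt 𝓘(ℝ, E) b₀).target) (hpU : orbitMap E b₀ p ∈ U) :
    pairing α (fun p => s (orbitMap E b₀ p)) (1, 0) p = sectionRate E α s (orbitMap E b₀ p) := by
  have := h.hamiltonian.smooth_action
  rw [pairing, h.tder_section_orbitMap hs hp hpU, ContinuousLinearMap.comp_apply,
    tder_orbitMap_time hp]
  rfl

theorem contMDiffAt_sectionRate (h : IsHamiltonianBoothbyWang σ H π α)
    {U : Set B} {s : B → M} {k : M → Circle} (hs : IsLocalSection E F π U s k) {b : B}
    (hb : b ∈ U) : ContMDiffAt 𝓘(ℝ, E) 𝓘(ℝ, ℝ) ∞ (sectionRate E α s) b := by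
  have h0 : orbitMap E b ((0 : ℝ), extChartAt 𝓘(ℝ, E) b b) = b := by
    simp [orbitMap]
  have h1 := (contDiffAt_pairing h.connection.smooth (h.contMDiffAt_section_orbitMap hs
    (b₀ := b) (p := ((0 : ℝ), extChartAt 𝓘(ℝ, E) b b)) (mem_extChartAt_target b)
    (h0.symm ▸ hb)) (1, 0))
  have h2 : ContMDiffAt 𝓘(ℝ, E) 𝓘(ℝ, ℝ × E) ∞
      (fun b' => ((0 : ℝ), extChartAt 𝓘(ℝ, E) b b')) b :=
    contMDiffAt_const.prodMk_space contMDiffAt_extChartAt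
  refine (ContMDiffAt.comp b h1.contMDiffAt h2).congr_of_eventuallyEq ?_
  filter_upwards [extChartAt_source_mem_nhds (I := 𝓘(ℝ, E)) b, hs.isOpen.mem_nhds hb] with b' h3 h4
  have h5 : orbitMap E b ((0 : ℝ), extChartAt 𝓘(ℝ, E) b b') = b' := by
    simp only [orbitMap, Circle.exp_zero, one_smul]
    exact (extChartAt 𝓘(ℝ, E) b).left_inv h3
  have h6 := h.pairing_section_orbitMap hs (b₀ := b) (p := ((0 : ℝ), extChartAt 𝓘(ℝ, E) b b'))
    ((extChartAt 𝓘(ℝ, E) b).map_source h3) (h5.symm ▸ h4)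
  rw [h5] at h6
  exact h6.symm

theorem isSmoothField_liftField [IsManifold 𝓘(ℝ, F) 1 M] (h : IsHamiltonianBoothbyWang σ H π α) :
    IsSmoothField (E := F) (M := M) (liftField E H π α) := by
  have := h.bundle.smooth_action
  have := h.hamiltonian.smooth_action
  intro x₀
  obtain ⟨U, s, k, hU, hs⟩ := h.bundle.exists_isLocalSection (π x₀)
  have hπc := h.bundle.smooth_proj
  have hm : ContMDiff (𝓘(ℝ, ℝ).prod 𝓘(ℝ, F)) 𝓘(ℝ, E) ∞
      (fun p : ℝ × M => Circle.exp p.1 • π p.2) :=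
    (contMDiff_circleExp.comp contMDiff_fst).smul (hπc.comp contMDiff_snd)
  let O : Set (ℝ × M) := {p | π p.2 ∈ U ∧ Circle.exp p.1 • π p.2 ∈ U}
  have hO : IsOpen O :=
    (hs.isOpen.preimage (hπc.continuous.comp continuous_snd)).inter (hs.isOpen.preimage hm.continuous)
  let r : B → ℝ := fun b => H b - sectionRate E α s b
  have hr : ContMDiffOn 𝓘(ℝ, E) 𝓘(ℝ, ℝ) ∞ r U := fun b hb =>
    (h.hamiltonian.smooth.contMDiffAt.sub
      (h.contMDiffAt_sectionRate hs hb)).contMDiffWithinAt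
  have hrp : ContMDiffOn (𝓘(ℝ, ℝ).prod 𝓘(ℝ, F)) 𝓘(ℝ, ℝ) ∞ (fun p : ℝ × M => r (π p.2)) O :=
    hr.comp (hπc.comp contMDiff_snd).contMDiffOn fun p hp => hp.1
  have hmul : ContMDiffOn (𝓘(ℝ, ℝ).prod 𝓘(ℝ, F)) 𝓘(ℝ, ℝ) ∞
      (fun p : ℝ × M => p.1 * r (π p.2)) O :=
    contMDiff_fst.contMDiffOn.mul hrp
  -- Only the velocity at time 0 matters, so the angle may grow at the rate frozen at `π x`. This
  -- family is not the flow, but it avoids any smoothness question about an integral.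
  refine contMDiffAt_velocity
    (f := fun p => Circle.exp (p.1 * r (π p.2)) • k p.2 • s (Circle.exp p.1 • π p.2))
    hO ?_ (x₀ := x₀) ⟨hU, by simpa using hU⟩ ?_ ?_
  · refine ContMDiffOn.smul (I := 𝓡 1) (contMDiff_circleExp.comp_contMDiffOn hmul)
      (ContMDiffOn.smul (I := 𝓡 1) ?_ ?_)
    · exact hs.smooth_coord.comp contMDiff_snd.contMDiffOn fun p hp => hp.1
    · exact hs.smooth_section.comp hm.contMDiffOn fun p hp => hp.2
  · filter_upwards [(hs.isOpen.preimage hπc.continuous).mem_nhds hU] with x hx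
    simpa using hs.coord_smul_section x hx
  · filter_upwards [(hs.isOpen.preimage hπc.continuous).mem_nhds hU] with x hx
    have hρ : HasDerivAt (fun t : ℝ => t * r (π x)) (r (π x)) 0 := by
      simpa using (hasDerivAt_id (0 : ℝ)).mul_const (r (π x))
    obtain ⟨-, h2, h3⟩ := h.lift_curve hs (k x) (b := π x) (t := 0) (by simpa using hx)
      hρ.differentiableAt
    have h4 : Circle.exp ((0 : ℝ) * r (π x)) • k x • s (Circle.exp 0 • π x) = x := by
      simpa using hs.coord_smul_section x hx
    rw [h4, Circle.exp_zero, one_smul] at h2 h3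
    refine (h.eq_liftField h2 (h3.trans ?_)).symm
    rw [hρ.deriv]
    simp [r]

end IsHamiltonianBoothbyWang

end Reeb

/-! ### Differentiation under the integral sign -/

section ParametricIntegral

variable {E : Type*} [NormedAddCommGroup E] [NormedSpace ℝ E]

/-- Differentiation under the integral sign, when the partial derivatives of the integrand have
known primitives. -/
theorem differentiableAt_integral_of_primitive {K : ℝ × E → ℝ} {O : Set (ℝ × E)} (hO : IsOpen O)
    (hK : ContDiffOn ℝ ∞ K O) {t : ℝ} {y : E} (hseg : ∀ s ∈ uIcc 0 t, (s, y) ∈ O)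
    {b : E → ℝ → ℝ}
    (hb : ∀ w, ∀ s ∈ uIcc 0 t, HasDerivAt (b w) (fderiv ℝ K (s, y) (0, w)) s) :
    DifferentiableAt ℝ (fun z => ∫ s in (0 : ℝ)..t, K (s, z)) y ∧
      ∀ w, fderiv ℝ (fun z => ∫ s in (0 : ℝ)..t, K (s, z)) y w = b w t - b w 0 := by
  have hDc : ContinuousOn (fderiv ℝ K) O := hK.continuousOn_fderiv_of_isOpen hO (by simp)
  have hcurve : ∀ z : E, Continuous fun s : ℝ => (s, z) := fun z => by fun_prop
  have hDs : ContinuousOn (fun s : ℝ => fderiv ℝ K (s, y)) (uIcc 0 t) :=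
    hDc.comp (hcurve y).continuousOn hseg
  obtain ⟨C, hC⟩ := isCompact_uIcc.exists_bound_of_continuousOn hDs
  -- The derivative is bounded by `C` on the compact segment; the tube lemma extends the bound `C +
  -- 1` to a neighbourhood of `y`, uniformly in time, which supplies the dominating constant.
  have hO' : IsOpen (O ∩ (fun p => ‖fderiv ℝ K p‖) ⁻¹' Iio (C + 1)) :=
    hDc.norm.isOpen_inter_preimage hO isOpen_Iio
  obtain ⟨u, v, -, hv, hu, hyv, huv⟩ := generalized_tube_lemma isCompact_uIcc
    (isCompact_singleton (x := y)) hO' (s := uIcc 0 t) (by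
      rintro ⟨s, z⟩ ⟨hs, rfl⟩
      exact ⟨hseg s hs, lt_of_le_of_lt (hC s hs) (by linarith)⟩)
  have hvn : v ∈ 𝓝 y := hv.mem_nhds (hyv rfl)
  have hmem : ∀ s ∈ uIcc 0 t, ∀ z ∈ v, (s, z) ∈ O ∧ ‖fderiv ℝ K (s, z)‖ < C + 1 :=
    fun s hs z hz => huv ⟨hu hs, hz⟩
  have hKs : ∀ z ∈ v, ContinuousOn (fun s : ℝ => K (s, z)) (uIcc 0 t) := fun z hz =>
    hK.continuousOn.comp (hcurve z).continuousOn fun s hs => (hmem s hs z hz).1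
  let D : E → ℝ → E →L[ℝ] ℝ := fun z s => (fderiv ℝ K (s, z)).comp (.inr ℝ ℝ E)
  have hD : ContinuousOn (D y) (uIcc 0 t) := hDs.clm_comp continuousOn_const
  have hmeas : MeasurableSet (uIoc (0 : ℝ) t) := measurableSet_uIoc
  have key := intervalIntegral.hasFDerivAt_integral_of_dominated_of_fderiv_le (𝕜 := ℝ)
    (μ := MeasureTheory.volume) (a := 0) (b := t) (F := fun z s => K (s, z)) (F' := D) (x₀ := y)
    (s := v) (bound := fun _ => C + 1) hvn
    (Filter.eventually_of_mem hvn fun z hz =>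
      ((hKs z hz).mono uIoc_subset_uIcc).aestronglyMeasurable hmeas)
    (hKs y (hyv rfl)).intervalIntegrable
    ((hD.mono uIoc_subset_uIcc).aestronglyMeasurable hmeas)
    (Filter.Eventually.of_forall fun s hs z hz => by
      have h1 := (hmem s (uIoc_subset_uIcc hs) z hz).2.le
      refine ((fderiv ℝ K (s, z)).opNorm_comp_le _).trans ?_
      have h2 := ContinuousLinearMap.norm_inr_le_one ℝ ℝ E
      nlinarith [norm_nonneg (fderiv ℝ K (s, z))])
    intervalIntegrable_const
    (Filter.Eventually.of_forall fun s hs z hz => by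
      have h1 := (hmem s (uIoc_subset_uIcc hs) z hz).1
      have h2 := ((hK.contDiffAt (hO.mem_nhds h1)).differentiableAt (by simp)).hasFDerivAt
      exact h2.comp z (hasFDerivAt_prodMk_right s z))
  refine ⟨key.differentiableAt, fun w => ?_⟩
  rw [key.fderiv, ContinuousLinearMap.intervalIntegral_apply hD.intervalIntegrable]
  exact intervalIntegral.integral_eq_sub_of_hasDerivAt (fun s hs => hb w s hs)
    ((hDs.clm_apply continuousOn_const).intervalIntegrable)

end ParametricIntegral

/-! ### Explicit local flows preserving the connection form -/

section LocalFlow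

variable {E : Type*} [NormedAddCommGroup E] [NormedSpace ℝ E]
  {B : Type*} [TopologicalSpace B] [ChartedSpace E B] [MulAction Circle B]
  {F : Type*} [NormedAddCommGroup F] [NormedSpace ℝ F]
  {M : Type*} [TopologicalSpace M] [ChartedSpace F M] [MulAction Circle M]
  {σ : DiffForm E B 2} {H : B → ℝ} {π : M → B} {α : DiffForm F M 1}
  [IsManifold 𝓘(ℝ, E) ∞ B] [IsManifold 𝓘(ℝ, F) ∞ M]

/-- The angle by which parallel transport along an orbit has to be corrected to obtain the flow of
the lifted field. -/
def liftAngle (E : Type*) [NormedAddCommGroup E] [NormedSpace ℝ E]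
    {B : Type*} [TopologicalSpace B] [ChartedSpace E B] [MulAction Circle B]
    {F : Type*} [NormedAddCommGroup F] [NormedSpace ℝ F]
    {M : Type*} [TopologicalSpace M] [ChartedSpace F M]
    (H : B → ℝ) (α : DiffForm F M 1) (s : B → M) (t : ℝ) (b : B) : ℝ :=
  ∫ r in (0 : ℝ)..t, (H (Circle.exp r • b) - sectionRate E α s (Circle.exp r • b))

namespace IsHamiltonianBoothbyWang

theorem hasDerivAt_liftAngle (h : IsHamiltonianBoothbyWang σ H π α)
    {U : Set B} {s : B → M} {k : M → Circle} (hs : IsLocalSection E F π U s k)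
    {b : B} {δ : ℝ} (hb : ∀ t ∈ Ioo (-δ) δ, Circle.exp t • b ∈ U) {t : ℝ} (ht : t ∈ Ioo (-δ) δ) :
    HasDerivAt (fun t => liftAngle E H α s t b)
      (H (Circle.exp t • b) - sectionRate E α s (Circle.exp t • b)) t := by
  have := h.hamiltonian.smooth_action
  have hc : ContinuousOn
      (fun r : ℝ => H (Circle.exp r • b) - sectionRate E α s (Circle.exp r • b)) (Ioo (-δ) δ) := by
    intro r hr
    have h1 : ContinuousAt (fun b => H b - sectionRate E α s b) (Circle.exp r • b) :=
      h.hamiltonian.smooth.continuous.continuousAt.sub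
        (h.contMDiffAt_sectionRate hs (hb r hr)).continuousAt
    exact (ContinuousAt.comp (f := fun r : ℝ => Circle.exp r • b) h1
      (contMDiff_orbit (F := E) b).continuous.continuousAt).continuousWithinAt
  have h0 : (0 : ℝ) ∈ Ioo (-δ) δ := by constructor <;> linarith [ht.1, ht.2]
  have hsub : uIcc 0 t ⊆ Ioo (-δ) δ := (ordConnected_Ioo (a := -δ) (b := δ)).uIcc_subset h0 ht
  exact intervalIntegral.integral_hasDerivAt_right (hc.mono hsub).intervalIntegrable
    (hc.stronglyMeasurableAtFilter isOpen_Ioo t ht) (hc.continuousAt (isOpen_Ioo.mem_nhds ht))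

omit [IsManifold 𝓘(ℝ, F) ∞ M] in
theorem pairing_section_orbitMap_snd (h : IsHamiltonianBoothbyWang σ H π α)
    {U : Set B} {s : B → M} {k : M → Circle} (hs : IsLocalSection E F π U s k) {b : B} {t : ℝ}
    (ht : Circle.exp t • b ∈ U) (w : E) :
    pairing α (fun p => s (orbitMap E b p)) ((0 : ℝ), w) (t, extChartAt 𝓘(ℝ, E) b b) =
      α.functional (s (Circle.exp t • b))
        (tder (E := E) (E' := F) (fun b' => s (Circle.exp t • b')) b w) := by
  have := h.hamiltonian.smooth_action
  let y := extChartAt 𝓘(ℝ, E) b b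
  have hy : (extChartAt 𝓘(ℝ, E) b).symm y = b := extChartAt_to_inv b
  have hob : orbitMap E b (t, y) = Circle.exp t • b := by rw [orbitMap, hy]
  have hd : HasFDerivAt (fun z : E => (t, z)) (ContinuousLinearMap.inr ℝ ℝ E) y :=
    hasFDerivAt_prodMk_right t y
  have hbox := (h.contMDiffAt_section_orbitMap hs (b₀ := b) (p := (t, y))
    (mem_extChartAt_target b) (hob ▸ ht)).mdifferentiableAt (by simp)
  have h1 := tder_comp (E := E) (E' := ℝ × E) (E'' := F) (g := fun p => s (orbitMap E b p))
    (f := fun z : E => (t, z)) y hbox hd.differentiableAt.mdifferentiableAt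
  have hsm : MDifferentiableAt 𝓘(ℝ, E) 𝓘(ℝ, F) (fun b' => s (Circle.exp t • b')) b :=
    (hs.mdifferentiableAt ht).comp b ((contMDiff_smul_left _).mdifferentiableAt (by simp))
  have h2 := tder_comp (E := E) (E' := E) (E'' := F) (g := fun b' => s (Circle.exp t • b'))
    (f := fun z => (extChartAt 𝓘(ℝ, E) b).symm z) y (hy.symm ▸ hsm)
    ((contMDiffAt_extChartAt_symm_self b).mdifferentiableAt (by simp))
  have h3 : tder (E := E) (E' := E) (fun z => (extChartAt 𝓘(ℝ, E) b).symm z) y = .id ℝ E :=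
    tder_extChartAt_symm_self b
  rw [h3, hy] at h2
  rw [tder_eq_fderiv, hd.fderiv] at h1
  have h4 := DFunLike.congr_fun (h1.symm.trans h2) w
  rw [pairing, hob]
  exact congrArg (α.functional _) h4

/-- This is where curvature meets the Hamiltonian equation. The derivative of the integrand in a
base direction is a total time derivative, so the integral collapses to boundary terms; these cancel
the change of the connection form along the moving section. -/
theorem tder_liftAngle (h : IsHamiltonianBoothbyWang σ H π α)
    {U : Set B} {s : B → M} {k : M → Circle} (hs : IsLocalSection E F π U s k)
    {b : B} {t : ℝ} (hb : ∀ r ∈ uIcc 0 t, Circle.exp r • b ∈ U) :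
    MDifferentiableAt 𝓘(ℝ, E) 𝓘(ℝ, ℝ) (liftAngle E H α s t) b ∧
    ∀ w, tder (E := E) (E' := ℝ) (liftAngle E H α s t) b w =
      α.functional (s b) (tder (E := E) (E' := F) s b w) -
      α.functional (s (Circle.exp t • b))
        (tder (E := E) (E' := F) (fun b' => s (Circle.exp t • b')) b w) := by
  have := h.hamiltonian.smooth_action
  let y := extChartAt 𝓘(ℝ, E) b b
  have hy : (extChartAt 𝓘(ℝ, E) b).symm y = b := extChartAt_to_inv b
  have hob : ∀ r, orbitMap E b (r, y) = Circle.exp r • b := fun r => by rw [orbitMap, hy]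
  let O : Set (ℝ × E) :=
    {p | p.2 ∈ (extChartAt 𝓘(ℝ, E) b).target} ∩ orbitMap E b ⁻¹' U
  have hT : IsOpen {p : ℝ × E | p.2 ∈ (extChartAt 𝓘(ℝ, E) b).target} :=
    (isOpen_extChartAt_target b).preimage continuous_snd
  have hO : IsOpen O := ContinuousOn.isOpen_inter_preimage
    (fun p hp => (contMDiffAt_orbitMap hp).continuousAt.continuousWithinAt) hT hs.isOpen
  let K : ℝ × E → ℝ := fun p => H (orbitMap E b p) - sectionRate E α s (orbitMap E b p)
  have hbox : ∀ p ∈ O, ContMDiffAt 𝓘(ℝ, ℝ × E) 𝓘(ℝ, F) ∞ (fun p => s (orbitMap E b p)) p :=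
    fun p hp => h.contMDiffAt_section_orbitMap hs hp.1 hp.2
  have hpair : ∀ p ∈ O, ∀ η,
      DifferentiableAt ℝ (pairing α (fun p => s (orbitMap E b p)) η) p := fun p hp η =>
    (contDiffAt_pairing h.connection.smooth (hbox p hp) η).differentiableAt (by simp)
  have hHo : ∀ p ∈ O, ContDiffAt ℝ ∞ (fun p => H (orbitMap E b p)) p := fun p hp =>
    (h.hamiltonian.smooth.contMDiffAt.comp p (contMDiffAt_orbitMap hp.1)).contDiffAt
  have hKeq : EqOn K (fun p => H (orbitMap E b p) -
      pairing α (fun p => s (orbitMap E b p)) (1, 0) p) O := fun p hp => by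
    simp only [K, h.pairing_section_orbitMap hs hp.1 hp.2]
  have hK : ContDiffOn ℝ ∞ K O := by
    refine ContDiffOn.congr (fun p hp => ?_) hKeq
    exact ((hHo p hp).sub
      (contDiffAt_pairing h.connection.smooth (hbox p hp) _)).contDiffWithinAt
  have hseg : ∀ r ∈ uIcc 0 t, (r, y) ∈ O := fun r hr =>
    ⟨mem_extChartAt_target b, by rw [mem_preimage, hob]; exact hb r hr⟩
  -- With ∂ₜ the time direction, the structure equation reads ∂ₜ(α(w)) - ∂_w(α(∂ₜ)) = σ(X, w) =
  -- -dH(w), so ∂_w(H - α(∂ₜ)) = -∂ₜ(α(w)).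
  have hKd : ∀ p ∈ O, ∀ w, fderiv ℝ K p ((0 : ℝ), w) =
      -fderiv ℝ (pairing α (fun p => s (orbitMap E b p)) ((0 : ℝ), w)) p (1, 0) := by
    intro p hp w
    have e1 := fderiv_pairing_sub h.connection.smooth (hbox p hp) ((1 : ℝ), (0 : E)) ((0 : ℝ), w)
    have hsd := hs.mdifferentiableAt hp.2
    rw [h.connection.pair_extDer, h.tder_section_orbitMap hs hp.1 hp.2] at e1
    simp only [ContinuousLinearMap.comp_apply] at e1
    rw [hs.tder_proj_section h.bundle hp.2, hs.tder_proj_section h.bundle hp.2,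
      tder_orbitMap_time hp.1, hs.proj_section _ hp.2, h.hamiltonian.pair_gen] at e1
    have e2 : fderiv ℝ (fun p => H (orbitMap E b p)) p ((0 : ℝ), w) =
        tder (E := E) (E' := ℝ) H (orbitMap E b p)
          (tder (E := ℝ × E) (E' := E) (orbitMap E b) p ((0 : ℝ), w)) := by
      rw [← tder_eq_fderiv, tder_comp (E' := E) p (h.hamiltonian.mdifferentiableAt _)
        ((contMDiffAt_orbitMap hp.1).mdifferentiableAt (by simp))]
      rfl
    have e3 : fderiv ℝ K p = fderiv ℝ (fun p => H (orbitMap E b p)) p -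
        fderiv ℝ (pairing α (fun p => s (orbitMap E b p)) (1, 0)) p := by
      rw [(hKeq.eventuallyEq_of_mem (hO.mem_nhds hp)).fderiv_eq]
      exact fderiv_fun_sub ((hHo p hp).differentiableAt (by simp)) (hpair p hp _)
    rw [e3, sub_apply, e2]
    linarith
  obtain ⟨hd, hdv⟩ := differentiableAt_integral_of_primitive hO hK hseg
    (b := fun w r => -pairing α (fun p => s (orbitMap E b p)) ((0 : ℝ), w) (r, y))
    (fun w r hr => by
      rw [hKd _ (hseg r hr)]
      have hc : HasDerivAt (fun r : ℝ => (r, y)) ((1 : ℝ), (0 : E)) r :=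
        (hasDerivAt_id r).prodMk (hasDerivAt_const r y)
      exact ((hpair _ (hseg r hr) ((0 : ℝ), w)).hasFDerivAt.comp_hasDerivAt r hc).neg)
  have : IsManifold 𝓘(ℝ, E) 1 B := .of_le (n := ∞) (by simp)
  have hext : MDifferentiableAt 𝓘(ℝ, E) 𝓘(ℝ, E) (extChartAt 𝓘(ℝ, E) b) b :=
    mdifferentiableAt_extChartAt (by simp)
  have hloc : liftAngle E H α s t =ᶠ[𝓝 b]
      fun b' => (fun z => ∫ r in (0 : ℝ)..t, K (r, z)) (extChartAt 𝓘(ℝ, E) b b') := by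
    filter_upwards [extChartAt_source_mem_nhds (I := 𝓘(ℝ, E)) b] with b' hb'
    simp only [liftAngle, K, orbitMap, (extChartAt 𝓘(ℝ, E) b).left_inv hb']
  have hdm : MDifferentiableAt 𝓘(ℝ, E) 𝓘(ℝ, ℝ) (fun z => ∫ r in (0 : ℝ)..t, K (r, z))
    (extChartAt 𝓘(ℝ, E) b b) := hd.mdifferentiableAt
  refine ⟨(hdm.comp b hext).congr_of_eventuallyEq hloc, fun w => ?_⟩
  have hid : tder (E := E) (E' := E) (extChartAt 𝓘(ℝ, E) b) b = .id ℝ E :=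
    mfderiv_extChartAt_self
  rw [tder_congr hloc, tder_comp (E' := E) (g := fun z => ∫ r in (0 : ℝ)..t, K (r, z)) b hdm hext,
    hid, ContinuousLinearMap.comp_id, tder_eq_fderiv, hdv]
  have h0 := h.pairing_section_orbitMap_snd hs (b := b) (t := 0) (hb 0 left_mem_uIcc) w
  have ht := h.pairing_section_orbitMap_snd hs (b := b) (t := t) (hb t right_mem_uIcc) w
  rw [ht, h0]
  simp only [Circle.exp_zero, one_smul]
  ring

/-- Near every point of the base, the lifted field has a local flow, which preserves the
connection form. -/
theorem exists_localFlow (h : IsHamiltonianBoothbyWang σ H π α) (b₀ : B) :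
    ∃ V ∈ 𝓝 b₀, ∃ δ > 0, ∃ Φ : ℝ → M → M, ∀ x, π x ∈ V → Φ 0 x = x ∧
      IsMIntegralCurveOn (I := 𝓘(ℝ, F)) (fun t => Φ t x) (liftField E H π α) (Ioo (-δ) δ) ∧
      ∀ t ∈ Ioo (-δ) δ, MDifferentiableAt 𝓘(ℝ, F) 𝓘(ℝ, F) (Φ t) x ∧
        ∀ v, α.functional (Φ t x) (tder (E := F) (E' := F) (Φ t) x v) = α.functional x v := by
  have := h.bundle.smooth_action
  have := h.hamiltonian.smooth_action
  obtain ⟨U, s, k, hU, hs⟩ := h.bundle.exists_isLocalSection b₀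
  have hc : Continuous (fun p : ℝ × B => Circle.exp p.1 • p.2) :=
    (contMDiff_exp_smul (F := E) (M := B)).continuous
  have hn : (fun p : ℝ × B => Circle.exp p.1 • p.2) ⁻¹' U ∈ 𝓝 ((0 : ℝ), b₀) :=
    (hs.isOpen.preimage hc).mem_nhds (by simpa using hU)
  rw [nhds_prod_eq, Filter.mem_prod_iff] at hn
  obtain ⟨T, hT, V, hV, hTV⟩ := hn
  obtain ⟨δ, hδ, hδT⟩ := Metric.mem_nhds_iff.1 hT
  rw [Real.ball_eq_Ioo, zero_sub, zero_add] at hδT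
  have hmem : ∀ t ∈ Ioo (-δ) δ, ∀ b ∈ V, Circle.exp t • b ∈ U := fun t ht b hb =>
    hTV (mk_mem_prod (hδT ht) hb)
  have h0 : (0 : ℝ) ∈ Ioo (-δ) δ := ⟨by linarith, hδ⟩
  refine ⟨V, hV, δ, hδ, fun t x =>
    Circle.exp (liftAngle E H α s t (π x)) • k x • s (Circle.exp t • π x), fun x hx => ?_⟩
  have hxU : π x ∈ U := by simpa using hmem 0 h0 _ hx
  refine ⟨by simpa [liftAngle] using hs.coord_smul_section x hxU, fun t ht => ?_, fun t ht => ?_⟩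
  · have hr := h.hasDerivAt_liftAngle hs (fun t ht => hmem t ht _ hx) ht
    obtain ⟨h1, h2, h3⟩ := h.lift_curve hs (k x) (hmem t ht _ hx) hr.differentiableAt
    rw [hr.deriv, sub_add_cancel] at h3
    have hp : π (Circle.exp (liftAngle E H α s t (π x)) • k x • s (Circle.exp t • π x)) =
        Circle.exp t • π x := by
      rw [h.bundle.proj_smul, h.bundle.proj_smul, hs.proj_section _ (hmem t ht _ hx)]
    have h4 := h.eq_liftField (h2.trans (by rw [hp])) (h3.trans (by rw [hp]))
    refine ((congrArg (HasMFDerivAt 𝓘(ℝ, ℝ) 𝓘(ℝ, F) _ t) ?_).mp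
      h1.hasMFDerivAt).hasMFDerivWithinAt
    refine ContinuousLinearMap.ext_ring ?_
    exact h4.trans (one_smul ℝ _).symm
  · have hsub : uIcc 0 t ⊆ Ioo (-δ) δ := (ordConnected_Ioo (a := -δ) (b := δ)).uIcc_subset h0 ht
    obtain ⟨hA, hAd⟩ := h.tder_liftAngle hs (b := π x) (t := t)
      fun r hr => hmem r (hsub hr) _ hx
    -- The same `l` is used for `s (π x)` and for `s (Circle.exp t • π x)`. The first product is
    -- locally the identity, which eliminates `l` from the formula for the second.
    obtain ⟨l, hl⟩ := h.connection.exists_functional_smul_eq (F := F) (E₀ := F) (P := M)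
      (hs.mdifferentiableAt_coord h.bundle hxU)
    have hπd := h.bundle.mdifferentiableAt x
    have htU := hmem t ht _ hx
    have hst : MDifferentiableAt 𝓘(ℝ, E) 𝓘(ℝ, F) (fun b' => s (Circle.exp t • b')) (π x) :=
      (hs.mdifferentiableAt htU).comp (π x) ((contMDiff_smul_left _).mdifferentiableAt (by simp))
    have hq0 : MDifferentiableAt 𝓘(ℝ, F) 𝓘(ℝ, F) (fun x => s (π x)) x :=
      (hs.mdifferentiableAt hxU).comp x hπd
    have hqt : MDifferentiableAt 𝓘(ℝ, F) 𝓘(ℝ, F) (fun x => s (Circle.exp t • π x)) x :=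
      hst.comp x hπd
    have hAx : MDifferentiableAt 𝓘(ℝ, F) 𝓘(ℝ, ℝ) (fun x => liftAngle E H α s t (π x)) x :=
      hA.comp x hπd
    obtain ⟨-, l0⟩ := hl _ hq0
    obtain ⟨m1, lt⟩ := hl _ hqt
    refine ⟨(exp_smul_hasDeriv hAx m1).1, fun v => ?_⟩
    rw [h.connection.functional_exp_smul hAx m1, lt, tder_comp (E' := E) x hA hπd,
      ContinuousLinearMap.comp_apply, hAd,
      tder_comp (E' := E) (g := fun b' => s (Circle.exp t • b')) x hst hπd]
    have hid : (fun y => k y • s (π y)) =ᶠ[𝓝 x] fun y => y := by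
      filter_upwards [(hs.isOpen.preimage h.bundle.smooth_proj.continuous).mem_nhds hxU] with y hy
        using hs.coord_smul_section y hy
    have l1 := l0 v
    rw [tder_congr hid, tder_id, hs.coord_smul_section x hxU, tder_comp (E' := E) x
      (hs.mdifferentiableAt hxU) hπd] at l1
    simp only [ContinuousLinearMap.comp_apply, ContinuousLinearMap.id_apply] at l1 ⊢
    rw [l1]
    ring

end IsHamiltonianBoothbyWang

end LocalFlow

/-! ### Vanishing derivative implies locally constant -/

section LocallyConstant

variable {E : Type*} [NormedAddCommGroup E] [NormedSpace ℝ E]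
  {B : Type*} [TopologicalSpace B] [ChartedSpace E B] [IsManifold 𝓘(ℝ, E) ∞ B]
  {V : Type*} [NormedAddCommGroup V] [NormedSpace ℝ V]

/-- A function with vanishing derivative on a manifold is locally constant. -/
theorem isLocallyConstant_of_tder_eq_zero {f : B → V} (hf : MDifferentiable 𝓘(ℝ, E) 𝓘(ℝ, V) f)
    (h : ∀ b, tder (E := E) (E' := V) f b = 0) : IsLocallyConstant f := by
  rw [IsLocallyConstant.iff_eventually_eq]
  intro b
  obtain ⟨r, hr, hball⟩ := Metric.isOpen_iff.1 (isOpen_extChartAt_target (I := 𝓘(ℝ, E)) b) _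
    (mem_extChartAt_target (I := 𝓘(ℝ, E)) b)
  let c : E → B := fun y => (extChartAt 𝓘(ℝ, E) b).symm y
  have hc : ∀ y ∈ Metric.ball (extChartAt 𝓘(ℝ, E) b b) r,
      MDifferentiableAt 𝓘(ℝ, E) 𝓘(ℝ, E) c y := fun y hy =>
    ((contMDiffOn_extChartAt_symm (n := ∞) b).contMDiffAt
      ((isOpen_extChartAt_target b).mem_nhds (hball hy))).mdifferentiableAt (by simp)
  have hd : ∀ y ∈ Metric.ball (extChartAt 𝓘(ℝ, E) b b) r,
      DifferentiableAt ℝ (fun y => f (c y)) y := fun y hy =>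
    ((hf (c y)).comp y (hc y hy)).differentiableAt
  have h1 : ∀ᶠ b' in 𝓝 b, extChartAt 𝓘(ℝ, E) b b' ∈ Metric.ball (extChartAt 𝓘(ℝ, E) b b) r :=
    (continuousAt_extChartAt b).eventually_mem (Metric.ball_mem_nhds _ hr)
  filter_upwards [h1, extChartAt_source_mem_nhds (I := 𝓘(ℝ, E)) b] with b' h1 h2
  have h3 := Metric.isOpen_ball.is_const_of_fderiv_eq_zero (𝕜 := ℝ)
    (convex_ball (extChartAt 𝓘(ℝ, E) b b) r).isPreconnected
    (fun y hy => (hd y hy).differentiableWithinAt) (fun y hy => by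
      rw [← tder_eq_fderiv, tder_comp (E' := E) y (hf (c y)) (hc y hy), h]
      rfl) h1 (Metric.mem_ball_self hr)
  simp only [c] at h3
  rwa [(extChartAt 𝓘(ℝ, E) b).left_inv h2, extChartAt_to_inv] at h3

end LocallyConstant

/-! ### Global flow and constant holonomy -/

section Flow

variable {E : Type*} [NormedAddCommGroup E] [NormedSpace ℝ E]
  {B : Type*} [TopologicalSpace B] [ChartedSpace E B] [MulAction Circle B]
  {F : Type*} [NormedAddCommGroup F] [NormedSpace ℝ F]
  {M : Type*} [TopologicalSpace M] [ChartedSpace F M] [MulAction Circle M]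
  {σ : DiffForm E B 2} {H : B → ℝ} {π : M → B} {α : DiffForm F M 1}
  [IsManifold 𝓘(ℝ, E) ∞ B] [IsManifold 𝓘(ℝ, F) ∞ M]

namespace IsHamiltonianBoothbyWang

/-- The local existence time depends only on the base point, so finitely many neighbourhoods in the
compact base suffice. -/
theorem exists_uniform_localFlow [CompactSpace B] (h : IsHamiltonianBoothbyWang σ H π α) :
    ∃ δ > 0, ∀ x₀ : M, ∃ Φ : ℝ → M → M, ∀ᶠ x in 𝓝 x₀, Φ 0 x = x ∧
      IsMIntegralCurveOn (I := 𝓘(ℝ, F)) (fun t => Φ t x) (liftField E H π α) (Ioo (-δ) δ) ∧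
      ∀ t ∈ Ioo (-δ) δ, MDifferentiableAt 𝓘(ℝ, F) 𝓘(ℝ, F) (Φ t) x ∧
        ∀ v, α.functional (Φ t x) (tder (E := F) (E' := F) (Φ t) x v) = α.functional x v := by
  choose V hV δ hδ Φ hΦ using h.exists_localFlow
  obtain ⟨t, ht⟩ := CompactSpace.elim_nhds_subcover (fun b => interior (V b))
    fun b => interior_mem_nhds.2 (hV b)
  have hmin : ∀ u : Finset B, ∃ ε > 0, ∀ b ∈ u, ε ≤ δ b := by
    classical
    intro u
    induction u using Finset.induction with
    | empty => exact ⟨1, one_pos, by simp⟩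
    | insert b u hb ih =>
      obtain ⟨ε, hε, hu⟩ := ih
      refine ⟨min ε (δ b), lt_min hε (hδ b), fun b' hb' => ?_⟩
      rcases Finset.mem_insert.1 hb' with rfl | hb'
      · exact min_le_right _ _
      · exact (min_le_left _ _).trans (hu b' hb')
  obtain ⟨ε, hε, hεt⟩ := hmin t
  refine ⟨ε, hε, fun x₀ => ?_⟩
  have hx : π x₀ ∈ ⋃ b ∈ t, interior (V b) := ht ▸ mem_univ _
  simp only [mem_iUnion] at hx
  obtain ⟨b, hb, hx⟩ := hx
  have hsub : Ioo (-ε) ε ⊆ Ioo (-δ b) (δ b) :=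
    Ioo_subset_Ioo (neg_le_neg (hεt b hb)) (hεt b hb)
  refine ⟨Φ b, ?_⟩
  filter_upwards [(isOpen_interior.preimage h.bundle.smooth_proj.continuous).mem_nhds hx] with x hx
  obtain ⟨h1, h2, h3⟩ := hΦ b x (interior_subset hx)
  exact ⟨h1, h2.mono hsub, fun t ht => h3 t (hsub ht)⟩

omit [IsManifold 𝓘(ℝ, E) ∞ B] [IsManifold 𝓘(ℝ, F) ∞ M] in
theorem isMIntegralCurve_smul (h : IsHamiltonianBoothbyWang σ H π α) {γ : ℝ → M}
    (hγ : IsMIntegralCurve (I := 𝓘(ℝ, F)) γ (liftField E H π α)) (g : Circle) :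
    IsMIntegralCurve (I := 𝓘(ℝ, F)) (fun t => g • γ t) (liftField E H π α) := by
  have := h.bundle.smooth_action
  have hg : ∀ x : M, MDifferentiableAt 𝓘(ℝ, F) 𝓘(ℝ, F) (fun x : M => g • x) x := fun x =>
    (contMDiff_smul_left g).mdifferentiableAt (by simp)
  have hγd : ∀ t, MDifferentiableAt 𝓘(ℝ, ℝ) 𝓘(ℝ, F) γ t := fun t => (hγ t).mdifferentiableAt
  refine isMIntegralCurve_of_tder (fun t => (hg _).comp t (hγd t)) fun t => ?_
  obtain ⟨h1, h2⟩ := h.liftField_spec (γ t)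
  rw [tder_comp (E' := F) (g := fun x : M => g • x) t (hg _) (hγd t),
    ContinuousLinearMap.comp_apply, IsMIntegralCurve.tder_eq hγ]
  refine h.eq_liftField ?_ ?_
  · rw [h.bundle.tder_proj_smul, h1, h.bundle.proj_smul]
  · rw [h.connection.functional_smul, h2, h.bundle.proj_smul]

theorem integralCurve_unique [T2Space M] (h : IsHamiltonianBoothbyWang σ H π α) {γ γ' : ℝ → M}
    (hγ : IsMIntegralCurve (I := 𝓘(ℝ, F)) γ (liftField E H π α))
    (hγ' : IsMIntegralCurve (I := 𝓘(ℝ, F)) γ' (liftField E H π α)) (h0 : γ 0 = γ' 0) : γ = γ' := by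
  have : IsManifold 𝓘(ℝ, F) 1 M := .of_le (n := ∞) (by simp)
  exact isMIntegralCurve_Ioo_eq_of_contMDiff_boundaryless (t₀ := 0)
    (h.isSmoothField_liftField.of_le (by simp)) hγ hγ' h0

omit [IsManifold 𝓘(ℝ, F) ∞ M] in
theorem proj_integralCurve [T2Space B] (h : IsHamiltonianBoothbyWang σ H π α) {γ : ℝ → M}
    (hγ : IsMIntegralCurve (I := 𝓘(ℝ, F)) γ (liftField E H π α)) (t : ℝ) :
    π (γ t) = Circle.exp t • π (γ 0) := by
  have := h.hamiltonian.smooth_action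
  have : IsManifold 𝓘(ℝ, E) 1 B := .of_le (n := ∞) (by simp)
  have hγd : ∀ t, MDifferentiableAt 𝓘(ℝ, ℝ) 𝓘(ℝ, F) γ t := fun t => (hγ t).mdifferentiableAt
  have h1 : IsMIntegralCurve (I := 𝓘(ℝ, E)) (fun t => π (γ t)) (gen E) :=
    isMIntegralCurve_of_tder (fun t => (h.bundle.mdifferentiableAt _).comp t (hγd t)) fun t => by
      rw [tder_comp (E' := F) t (h.bundle.mdifferentiableAt _) (hγd t),
        ContinuousLinearMap.comp_apply, IsMIntegralCurve.tder_eq hγ]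
      exact (h.liftField_spec (γ t)).1
  have h2 := isMIntegralCurve_Ioo_eq_of_contMDiff_boundaryless (t₀ := 0)
    ((isSmoothField_generator (F := E) (M := B)).of_le (by simp)) h1
    (isMIntegralCurve_orbit (π (γ 0))) (by simp)
  exact congrFun h2 t

omit [IsManifold 𝓘(ℝ, E) ∞ B] [IsManifold 𝓘(ℝ, F) ∞ M] in
-- Over a zero of the generator the lifted field is vertical, and its connection value is the
-- constant speed of rotation.
theorem isMIntegralCurve_fibre (h : IsHamiltonianBoothbyWang σ H π α) {x : M}
    (hx : gen E (π x) = 0) :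
    IsMIntegralCurve (I := 𝓘(ℝ, F)) (fun t : ℝ => Circle.exp (t * H (π x)) • x)
      (liftField E H π α) := by
  have := h.bundle.smooth_action
  have hρ : ∀ t : ℝ, HasDerivAt (fun t : ℝ => t * H (π x)) (H (π x)) t := fun t => by
    simpa using (hasDerivAt_id t).mul_const (H (π x))
  have hρd := fun t => (hρ t).differentiableAt.mdifferentiableAt
  have hq : ∀ t : ℝ, MDifferentiableAt 𝓘(ℝ, ℝ) 𝓘(ℝ, F) (fun _ : ℝ => x) t := fun t =>
    mdifferentiableAt_const
  have hd := fun t => (exp_smul_hasDeriv (hρd t) (hq t)).1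
  refine isMIntegralCurve_of_tder hd fun t => h.eq_liftField ?_ ?_
  · rw [h.bundle.proj_smul, hx]
    have h1 := tder_comp (E' := F) (g := π) (f := fun t : ℝ => Circle.exp (t * H (π x)) • x) t
      (h.bundle.mdifferentiableAt _) (hd t)
    simp only [h.bundle.proj_smul] at h1
    rw [tder_const] at h1
    exact (DFunLike.congr_fun h1 (1 : ℝ)).symm
  · rw [h.connection.functional_exp_smul (hρd t) (hq t), tder_const, tder_eq_fderiv,
      fderiv_apply_one_eq_deriv, (hρ t).deriv, h.bundle.proj_smul]
    simp

/-- The global flow of the lifted field; it preserves the connection form. -/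
theorem exists_flow [T2Space M] [CompactSpace B] (h : IsHamiltonianBoothbyWang σ H π α) :
    ∃ Φ : ℝ → M → M,
      (∀ γ : ℝ → M, IsMIntegralCurve (I := 𝓘(ℝ, F)) γ (liftField E H π α) →
        ∀ a t, γ (a + t) = Φ t (γ a)) ∧
      (∀ x, Φ 0 x = x) ∧
      (∀ x, IsMIntegralCurve (I := 𝓘(ℝ, F)) (fun t => Φ t x) (liftField E H π α)) ∧
      ∀ t x, MDifferentiableAt 𝓘(ℝ, F) 𝓘(ℝ, F) (Φ t) x ∧
        ∀ v, α.functional (Φ t x) (tder (E := F) (E' := F) (Φ t) x v) = α.functional x v := by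
  have : IsManifold 𝓘(ℝ, F) 1 M := .of_le (n := ∞) (by simp)
  have hR := (h.isSmoothField_liftField (F := F) (M := M)).of_le (by simp : (1 : ℕ∞ω) ≤ ∞)
  obtain ⟨δ, hδ, hloc⟩ := h.exists_uniform_localFlow
  have h0mem : (0 : ℝ) ∈ Ioo (-δ) δ := ⟨by linarith, hδ⟩
  have hex := exists_isMIntegralCurve_of_isMIntegralCurveOn hR hδ fun x => by
    obtain ⟨Φ, hΦ⟩ := hloc x
    obtain ⟨h1, h2, -⟩ := hΦ.self_of_nhds
    exact ⟨fun t => Φ t x, h1, h2⟩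
  choose Ψ hΨ0 hΨ using hex
  have hflow : ∀ γ : ℝ → M, IsMIntegralCurve (I := 𝓘(ℝ, F)) γ (liftField E H π α) →
      ∀ a t, γ (a + t) = Ψ (γ a) t := fun γ hγ a t => by
    have h1 := h.integralCurve_unique (hγ.comp_add a) (hΨ (γ a)) (by simp [hΨ0])
    rw [← h1, Function.comp_apply, add_comm]
  let good : ℝ → Prop := fun t => ∀ x, MDifferentiableAt 𝓘(ℝ, F) 𝓘(ℝ, F) (fun x => Ψ x t) x ∧
        ∀ v, α.functional (Ψ x t) (tder (E := F) (E' := F) (fun x => Ψ x t) x v) =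
          α.functional x v
  have hsmall : ∀ t ∈ Ioo (-δ) δ, good t := fun t ht x => by
    obtain ⟨Φ, hΦ⟩ := hloc x
    have heq : (fun x => Ψ x t) =ᶠ[𝓝 x] Φ t := by
      filter_upwards [hΦ] with x' hx'
      exact isMIntegralCurveOn_Ioo_eqOn_of_contMDiff_boundaryless h0mem hR
        ((hΨ x').isMIntegralCurveOn _) hx'.2.1 ((hΨ0 x').trans hx'.1.symm) ht
    obtain ⟨-, -, h3⟩ := hΦ.self_of_nhds
    obtain ⟨h4, h5⟩ := h3 t ht
    refine ⟨h4.congr_of_eventuallyEq heq, fun v => ?_⟩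
    rw [tder_congr heq, heq.eq_of_nhds]
    exact h5 v
  have hadd : ∀ a t, good a → good t → good (a + t) := fun a t ha ht x => by
    have heq : (fun x => Ψ x (a + t)) = fun x => Ψ (Ψ x a) t := funext fun x =>
      hflow _ (hΨ x) a t
    obtain ⟨a1, a2⟩ := ha x
    obtain ⟨t1, t2⟩ := ht (Ψ x a)
    rw [heq]
    refine ⟨t1.comp x a1, fun v => ?_⟩
    rw [tder_comp (E' := F) (g := fun x => Ψ x t) x t1 a1, congrFun heq x]
    exact (t2 _).trans (a2 v)
  have hmul : ∀ (n : ℕ) (t : ℝ), good t → good ((n + 1 : ℕ) * t) := fun n t ht => by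
    induction n with
    | zero => simpa using ht
    | succ n ih =>
      have := hadd _ _ ih ht
      convert this using 1
      push_cast
      ring
  -- Any time is a multiple of a time shorter than `δ`, and invariance is stable under composition;
  -- `n + 1` keeps the divisor nonzero.
  have hall : ∀ t, good t := fun t => by
    obtain ⟨n, hn⟩ := exists_nat_gt (|t| / δ)
    have hn' : |t| < (n + 1 : ℕ) * δ := by
      rw [div_lt_iff₀ hδ] at hn
      push_cast
      nlinarith
    have hpos : (0 : ℝ) < (n + 1 : ℕ) := by positivity
    have h1 := hmul n (t / (n + 1 : ℕ)) (hsmall _ (by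
      rw [mem_Ioo, ← abs_lt, abs_div, abs_of_pos hpos, div_lt_iff₀ hpos, mul_comm]
      exact hn'))
    rwa [mul_div_cancel₀ _ hpos.ne'] at h1
  exact ⟨fun t x => Ψ x t, hflow, hΨ0, hΨ, hall⟩

/-- All integral curves of the lifted field have the same holonomy over the orbits of the circle
action. -/
theorem integralCurve_add_two_pi [T2Space B] [T2Space M] [CompactSpace B] [PreconnectedSpace B]
    (h : IsHamiltonianBoothbyWang σ H π α) {p₀ : B}
    (hp₀ : p₀ ∈ MulAction.fixedPoints Circle B) {γ : ℝ → M}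
    (hγ : IsMIntegralCurve (I := 𝓘(ℝ, F)) γ (liftField E H π α)) (t : ℝ) :
    γ (t + 2 * Real.pi) = Circle.exp (2 * Real.pi * H p₀) • γ t := by
  have := h.bundle.smooth_action
  have := h.hamiltonian.smooth_action
  have : IsManifold 𝓘(ℝ, E) 1 B := .of_le (n := ∞) (by simp)
  obtain ⟨Φ, hflow, hΦ0, hΦ, hpres⟩ := h.exists_flow
  have hproj : ∀ x, π (Φ (2 * Real.pi) x) = π x := fun x => by
    rw [h.proj_integralCurve (hΦ x), hΦ0, Circle.exp_two_pi, one_smul]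
  have heqv : ∀ (g : Circle) x, Φ (2 * Real.pi) (g • x) = g • Φ (2 * Real.pi) x := fun g x => by
    have := h.integralCurve_unique (hΦ (g • x)) (h.isMIntegralCurve_smul (hΦ x) g)
      (by simp only [hΦ0])
    exact congrFun this _
  -- The flow commutes with the principal action and the circle is abelian, so one multiplier serves
  -- the whole fibre.
  have hhol : ∀ b, ∃ g : Circle, ∀ x, π x = b → Φ (2 * Real.pi) x = g • x := fun b => by
    obtain ⟨x, rfl⟩ := h.bundle.surjective b
    obtain ⟨g, hg⟩ := h.bundle.exists_smul_eq (hproj x).symm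
    refine ⟨g, fun y hy => ?_⟩
    obtain ⟨g', rfl⟩ := h.bundle.exists_smul_eq hy.symm
    rw [heqv, ← hg, smul_smul, smul_smul, mul_comm]
  choose hol hhol using hhol
  have hconst : IsLocallyConstant (fun b => (hol b : ℂ)) := by
    have key : ∀ b, MDifferentiableAt 𝓘(ℝ, E) 𝓘(ℝ, ℂ) (fun b => (hol b : ℂ)) b ∧
        tder (E := E) (E' := ℂ) (fun b => (hol b : ℂ)) b = 0 := fun b => by
      obtain ⟨U, s, k, hU, hs⟩ := h.bundle.exists_isLocalSection b
      have hsb := hs.proj_section b hU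
      have hUn : ∀ᶠ b' in 𝓝 b, b' ∈ U := hs.isOpen.mem_nhds hU
      have hk : hol =ᶠ[𝓝 b] fun b' => k (Φ (2 * Real.pi) (s b')) := by
        filter_upwards [hUn] with b' hb'
        have hsb' := hs.proj_section b' hb'
        rw [hhol b' _ hsb', hs.coord_smul _ _ (hsb'.symm ▸ hb'), hs.coord_section b' hb', mul_one]
      have hΦs : MDifferentiableAt 𝓘(ℝ, E) 𝓘(ℝ, F) (fun b' => Φ (2 * Real.pi) (s b')) b :=
        (hpres _ (s b)).1.comp b (hs.mdifferentiableAt hU)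
      have hhd : MDifferentiableAt 𝓘(ℝ, E) (𝓡 1) hol b :=
        MDifferentiableAt.congr_of_eventuallyEq (MDifferentiableAt.comp b
          (hs.mdifferentiableAt_coord h.bundle (by rw [hproj, hsb]; exact hU)) hΦs) hk
      obtain ⟨θ, hθ0, hθ, hexp⟩ := exists_angle hhd
      have hg := (contMDiff_smul_left (F := F) (M := M) (hol b)).mdifferentiableAt
        (x := s b) (by simp)
      have hq : MDifferentiableAt 𝓘(ℝ, E) 𝓘(ℝ, F) (fun b' => hol b • s b') b :=
        hg.comp b (hs.mdifferentiableAt hU)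
      have heq : (fun b' => Φ (2 * Real.pi) (s b')) =ᶠ[𝓝 b]
          fun b' => Circle.exp (θ b') • hol b • s b' := by
        filter_upwards [hUn] with b' hb'
        rw [hhol b' _ (hs.proj_section b' hb'), smul_smul, ← hexp]
      -- The time-2π flow of the section is `exp θ • hol b • s`. Invariance of the connection form
      -- gives its old value on the derivative, the product rule gives that value plus dθ; hence dθ
      -- = 0.
      have hθz : tder (E := E) (E' := ℝ) θ b = 0 := by
        ext w
        have e1 := (hpres (2 * Real.pi) (s b)).2 (tder (E := E) (E' := F) s b w)
        have e2 := h.connection.functional_exp_smul hθ hq w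
        rw [← tder_congr heq, ← heq.eq_of_nhds, tder_comp (E' := F) b
          (hpres (2 * Real.pi) (s b)).1 (hs.mdifferentiableAt hU), ContinuousLinearMap.comp_apply,
          e1, tder_comp (E' := F) (g := fun x : M => hol b • x) b hg (hs.mdifferentiableAt hU),
          ContinuousLinearMap.comp_apply, h.connection.functional_smul] at e2
        simpa using e2
      have hfun : (fun b' => (hol b' : ℂ)) =
          fun b' => (fun r : ℝ => (Circle.exp r : ℂ) * hol b) (θ b') := funext fun b' => by
        rw [hexp b', Circle.coe_mul]
      have hed : DifferentiableAt ℝ (fun r : ℝ => (Circle.exp r : ℂ) * hol b) (θ b) := by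
        simp only [Circle.coe_exp]
        fun_prop
      rw [hfun]
      refine ⟨hed.mdifferentiableAt.comp b hθ, ?_⟩
      rw [tder_comp (E' := ℝ) (g := fun r : ℝ => (Circle.exp r : ℂ) * hol b) b
        hed.mdifferentiableAt hθ, hθz, ContinuousLinearMap.comp_zero]
    exact isLocallyConstant_of_tder_eq_zero (fun b => (key b).1) fun b => (key b).2
  have hp : hol p₀ = Circle.exp (2 * Real.pi * H p₀) := by
    obtain ⟨x, rfl⟩ := h.bundle.surjective p₀
    have h1 := h.isMIntegralCurve_fibre (mem_fixedPoints_iff_gen.1 hp₀)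
    have h2 := h.integralCurve_unique (hΦ x) h1 (by simp [hΦ0])
    have h3 := congrFun h2 (2 * Real.pi)
    simp only [hhol _ x rfl] at h3
    have h4 : ((Circle.exp (2 * Real.pi * H (π x)))⁻¹ * hol (π x)) • x = x := by
      rw [mul_smul, h3, inv_smul_smul]
    exact (inv_mul_eq_one.1 (h.bundle.eq_one_of_smul_eq h4)).symm
  have hall : hol (π (γ t)) = hol p₀ :=
    Subtype.ext (hconst.apply_eq_of_isPreconnected isPreconnected_univ (mem_univ _) (mem_univ _))
  rw [hflow γ hγ, hhol _ _ rfl, hall, hp]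

end IsHamiltonianBoothbyWang

end Flow

/-! ### Commensurability of periods -/

section Algebra

variable {F : Type*} [NormedAddCommGroup F] [NormedSpace ℝ F]
  {M : Type*} [TopologicalSpace M] [ChartedSpace F M]

theorem DiffForm.pair_sub_left (β : DiffForm F M 2) (x : M) (v w u : F) :
    β.pair x (v - w) u = β.pair x v u - β.pair x w u := by
  let β' : F [⋀^Fin 2]→L[ℝ] ℝ := β x
  have h := β'.map_update_sub ![0, u] 0 v w
  have hu : ∀ z : F, Function.update ![0, u] 0 z = ![z, u] := fun z => by
    ext i
    fin_cases i <;> rfl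
  simp only [hu] at h
  exact h

/-- If a point is not fixed by a circle action, then every period of its orbit is commensurable
with `2π`. -/
theorem exists_int_mul_eq_of_exp_smul_eq [MulAction Circle M] [T2Space M]
    [ContMDiffSMul (𝓡 1) 𝓘(ℝ, F) ∞ Circle M] {x : M}
    (hx : x ∉ MulAction.fixedPoints Circle M) {T : ℝ} (hT : 0 < T) (h : Circle.exp T • x = x) :
    ∃ m n : ℤ, m ≠ 0 ∧ n * T = m * (2 * Real.pi) := by
  let S : AddSubgroup ℝ :=
    { carrier := {t | Circle.exp t • x = x}
      zero_mem' := by simp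
      add_mem' := fun {a b} ha hb => by
        simp only [mem_ofPred] at ha hb ⊢
        rw [Circle.exp_add, mul_smul, hb, ha]
      neg_mem' := fun {a} ha => by
        simp only [mem_ofPred] at ha ⊢
        rw [Circle.exp_neg, inv_smul_eq_iff, ha] }
  have hclosed : IsClosed (S : Set ℝ) :=
    isClosed_eq (contMDiff_orbit (F := F) x).continuous continuous_const
  rcases S.dense_or_cyclic with hd | ⟨a, ha⟩
  -- A dense closed subgroup is all of ℝ, which would make the point fixed.
  · refine absurd (fun g => ?_) hx
    obtain ⟨t, rfl⟩ := Circle.exp_surjective g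
    have : t ∈ (S : Set ℝ) := by
      rw [← hclosed.closure_eq, hd.closure_eq]
      exact mem_univ _
    exact this
  · have h1 : T ∈ S := h
    have h2 : 2 * Real.pi ∈ S := by
      change Circle.exp (2 * Real.pi) • x = x
      rw [Circle.exp_two_pi, one_smul]
    rw [ha, AddSubgroup.mem_closure_singleton] at h1 h2
    obtain ⟨m, hm⟩ := h1
    obtain ⟨n, hn⟩ := h2
    refine ⟨m, n, ?_, ?_⟩
    · rintro rfl
      simp only [zero_smul] at hm
      exact hT.ne hm
    · rw [← hm, ← hn]
      simp only [zsmul_eq_mul]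
      ring

end Algebra

/-! ### Normalisation, contact form, Reeb field and periodic orbits -/

section Main

variable {E : Type*} [NormedAddCommGroup E] [NormedSpace ℝ E]
  {B : Type*} [TopologicalSpace B] [ChartedSpace E B] [MulAction Circle B]
  {F : Type*} [NormedAddCommGroup F] [NormedSpace ℝ F]
  {M : Type*} [TopologicalSpace M] [ChartedSpace F M] [MulAction Circle M]
  {σ : DiffForm E B 2} {H : B → ℝ} {π : M → B} {α : DiffForm F M 1}
  [IsManifold 𝓘(ℝ, E) ∞ B]

/-- A Hamiltonian on a closed manifold can be normalised, since its minimum is attained at a fixed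
point. -/
theorem IsHamiltonianCircleAction.exists_isNormalised [T2Space B] [CompactSpace B] [Nonempty B]
    (hσ : IsSymplecticForm σ) (hH : IsHamiltonianCircleAction σ H) :
    ∃ c : ℝ, IsNormalised (fun b => H b + c) := by
  have := hH.smooth_action
  have : IsManifold 𝓘(ℝ, E) 1 B := .of_le (n := ∞) (by simp)
  obtain ⟨p, -, hp⟩ := isCompact_univ.exists_isMinOn univ_nonempty
    hH.smooth.continuous.continuousOn
  have hp' : ∀ b, H p ≤ H b := fun b => hp (mem_univ b)
  let c : E → B := fun y => (extChartAt 𝓘(ℝ, E) p).symm y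
  let y := extChartAt 𝓘(ℝ, E) p p
  have hcy : c y = p := extChartAt_to_inv p
  have hcd : tder (E := E) (E' := E) c y = .id ℝ E := tder_extChartAt_symm_self p
  have hmin : IsLocalMin (fun z => H (c z)) y :=
    Filter.Eventually.of_forall fun z => by simpa only [hcy] using hp' (c z)
  have hd0 : tder (E := E) (E' := ℝ) H p = 0 := by
    have h1 := hmin.fderiv_eq_zero
    rw [← tder_eq_fderiv, tder_comp (E' := E) y (hH.mdifferentiableAt _)
      ((contMDiffAt_extChartAt_symm_self p).mdifferentiableAt (by simp)), hcd,
      ContinuousLinearMap.comp_id] at h1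
    have h2 : tder (E := E) (E' := ℝ) H (c y) = 0 := h1
    rwa [hcy] at h2
  have hgen : gen E p = 0 := hσ.nondegenerate p (gen E p) fun w => by
    exact (hH.pair_gen p w).trans ((congrArg Neg.neg (DFunLike.congr_fun hd0 w)).trans neg_zero)
  -- The shift makes the minimum equal to 1, which is both positive and a natural number.
  refine ⟨1 - H p, fun b => ?_, p, mem_fixedPoints_iff_gen.2 hgen, 1, ?_⟩
  · have := hp' b
    change 0 < H b + (1 - H p)
    linarith
  · simp

namespace IsHamiltonianBoothbyWang

omit [IsManifold 𝓘(ℝ, E) ∞ B] in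
theorem smooth_inv_comp (h : IsHamiltonianBoothbyWang σ H π α) (hpos : ∀ b, 0 < H b) :
    ContMDiff 𝓘(ℝ, F) 𝓘(ℝ, ℝ) ∞ (fun x => (H (π x))⁻¹) := fun x =>
  (contDiffAt_inv ℝ (hpos (π x)).ne').contMDiffAt.comp x
    (h.hamiltonian.smooth.comp h.bundle.smooth_proj).contMDiffAt

omit [IsManifold 𝓘(ℝ, E) ∞ B] in
theorem tder_inv_comp (h : IsHamiltonianBoothbyWang σ H π α) (hpos : ∀ b, 0 < H b) (x : M)
    (v : F) : tder (E := F) (E' := ℝ) (fun x => (H (π x))⁻¹) x v =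
      -(H (π x) ^ 2)⁻¹ *
        tder (E := E) (E' := ℝ) H (π x) (tder (E := F) (E' := E) π x v) := by
  have hd := hasDerivAt_inv (hpos (π x)).ne'
  have hHπ : MDifferentiableAt 𝓘(ℝ, F) 𝓘(ℝ, ℝ) (fun x => H (π x)) x :=
    (h.hamiltonian.mdifferentiableAt _).comp x (h.bundle.mdifferentiableAt x)
  rw [tder_comp (E' := ℝ) (g := fun r : ℝ => r⁻¹) (f := fun x => H (π x)) x
    hd.differentiableAt.mdifferentiableAt hHπ,
    tder_comp (E' := E) x (h.hamiltonian.mdifferentiableAt _) (h.bundle.mdifferentiableAt x),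
    tder_eq_fderiv, hd.hasFDerivAt.fderiv]
  simp [mul_comm]

variable [IsManifold 𝓘(ℝ, F) ∞ M]

omit [IsManifold 𝓘(ℝ, E) ∞ B] in
/-- The quotient of the connection form by the Hamiltonian is a contact form. -/
theorem isContactForm (h : IsHamiltonianBoothbyWang σ H π α) (hpos : ∀ b, 0 < H b) :
    IsContactForm (fun x => (H (π x))⁻¹ • α x) where
  smooth := h.connection.smooth.smul (h.smooth_inv_comp hpos)
  ne_zero x hx := by
    have h1 := DiffForm.functional_smul (fun x => (H (π x))⁻¹) α x
    have h2 := DFunLike.congr_fun h1 (gen F x)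
    rw [DiffForm.functional_apply, hx] at h2
    rw [smul_apply, h.connection.functional_gen, smul_eq_mul, mul_one] at h2
    exact inv_ne_zero (hpos (π x)).ne' h2.symm
  nondegenerate x v hv hw := by
    have hne : (H (π x))⁻¹ ≠ 0 := inv_ne_zero (hpos (π x)).ne'
    have hα : ∀ u : F, α.functional x u = 0 ↔ ((H (π x))⁻¹ • α x) ![u] = 0 := fun u => by
      rw [← DiffForm.functional_apply (fun x => (H (π x))⁻¹ • α x), DiffForm.functional_smul]
      simp [hne]
    have hv' := (hα v).2 hv
    refine h.eq_of_proj_of_functional (Eq.trans ?_ (map_zero (tder (E := F) (E' := E) π x)).symm)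
      (hv'.trans (map_zero _).symm)
    refine h.symplectic.nondegenerate (π x) (tder (E := F) (E' := E) π x v) fun w => ?_
    -- A horizontal lift of `w` kills the dg ∧ α term, leaving a nonzero multiple of σ on the
    -- projections.
    obtain ⟨u, hu, hu'⟩ := h.exists_lift x w 0
    have h1 := hw u ((hα u).1 hu')
    have h2 := pair_extDer_smul (h.smooth_inv_comp hpos) h.connection.smooth x v u
    rw [hv', hu', mul_zero, mul_zero, sub_zero, add_zero] at h2
    have h3 := (mul_eq_zero.1 (h2.symm.trans h1)).resolve_left hne
    exact (congrArg (σ.pair (π x) _) hu.symm).trans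
      ((h.connection.pair_extDer x v u).symm.trans h3)

/-- The Reeb field of the quotient of the connection form by the Hamiltonian is the lift of the
generator of the circle action. -/
theorem isReebField_iff [IsManifold 𝓘(ℝ, F) 1 M] (h : IsHamiltonianBoothbyWang σ H π α)
    (hpos : ∀ b, 0 < H b) (R : (x : M) → TangentSpace 𝓘(ℝ, F) x) :
    IsReebField (fun x => (H (π x))⁻¹ • α x) R ↔ R = liftField E H π α := by
  have hnorm : ∀ x, DiffForm.functional (fun x => (H (π x))⁻¹ • α x) x (liftField E H π α x) = 1 :=
    fun x => by
      rw [DiffForm.functional_smul, smul_apply, (h.liftField_spec x).2, smul_eq_mul,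
        inv_mul_cancel₀ (hpos (π x)).ne']
  have hker : ∀ x v, DiffForm.pair (extDer (fun x => (H (π x))⁻¹ • α x)) x
      (liftField E H π α x) v = 0 := fun x v => by
    obtain ⟨h1, h2⟩ := h.liftField_spec x
    have hne := (hpos (π x)).ne'
    rw [pair_extDer_smul (h.smooth_inv_comp hpos) h.connection.smooth,
      h.connection.pair_extDer, h.tder_inv_comp hpos, h.tder_inv_comp hpos, h1, h2,
      h.hamiltonian.pair_gen, h.hamiltonian.tder_gen]
    field_simp
    ring
  constructor
  · intro hR
    funext x
    obtain ⟨r, hr⟩ : ∃ r : F, r = R x := ⟨R x, rfl⟩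
    have h1 : DiffForm.functional (fun x => (H (π x))⁻¹ • α x) x r = 1 :=
      (DiffForm.functional_apply (fun x => (H (π x))⁻¹ • α x) x r).trans
        (hr ▸ hR.normalised x)
    have h2 : ∀ w, DiffForm.pair (extDer (fun x => (H (π x))⁻¹ • α x)) x r w = 0 :=
      fun w => hr ▸ hR.kernel x w
    -- The difference of two candidates lies in the kernel of the contact form and of its
    -- derivative.
    have h3 := (h.isContactForm hpos).nondegenerate x (r - liftField E H π α x) (by
        refine (DiffForm.functional_apply (fun x => (H (π x))⁻¹ • α x) x _).symm.trans ?_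
        rw [map_sub, hnorm, h1, sub_self]) fun w _ =>
        (DiffForm.pair_sub_left (extDer (fun x => (H (π x))⁻¹ • α x)) x _ _ w).trans
          ((congrArg₂ (· - ·) (h2 w) (hker x w)).trans (sub_zero 0))
    exact hr.symm.trans (sub_eq_zero.1 h3)
  · rintro rfl
    exact ⟨h.isSmoothField_liftField, fun x =>
      (DiffForm.functional_apply (fun x => (H (π x))⁻¹ • α x) x _).symm.trans (hnorm x), hker⟩

/-- If the Hamiltonian is positive and takes an irrational value at some fixed point, then the
periodic orbits of the lifted field are the fibres over the fixed points. -/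
theorem isPeriodicOrbit_iff [T2Space B] [T2Space M] [CompactSpace B] [PreconnectedSpace B]
    (h : IsHamiltonianBoothbyWang σ H π α) (hpos : ∀ b, 0 < H b) {p₀ : B}
    (hp₀ : p₀ ∈ MulAction.fixedPoints Circle B) (hirr : Irrational (H p₀)) (O : Set M) :
    IsPeriodicOrbit (liftField E H π α) O ↔
      ∃ p ∈ MulAction.fixedPoints Circle B, π ⁻¹' {p} = O := by
  have := h.bundle.smooth_action
  have := h.hamiltonian.smooth_action
  have : IsManifold 𝓘(ℝ, E) 1 B := .of_le (n := ∞) (by simp)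
  have hrange : ∀ x : M,
      range (fun t : ℝ => Circle.exp (t * H (π x)) • x) = π ⁻¹' {π x} := fun x => by
    ext y
    constructor
    · rintro ⟨t, rfl⟩
      exact h.bundle.proj_smul _ _
    · intro hy
      obtain ⟨g, rfl⟩ := h.bundle.exists_smul_eq (show π x = π y from hy.symm)
      obtain ⟨t, rfl⟩ := Circle.exp_surjective g
      exact ⟨t / H (π x), by simp only [div_mul_cancel₀ _ (hpos (π x)).ne']⟩
  constructor
  · rintro ⟨γ, T, hγ, hT, hper, rfl⟩
    have hfix : π (γ 0) ∈ MulAction.fixedPoints Circle B := by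
      by_contra hnot
      have hclosed : Circle.exp T • π (γ 0) = π (γ 0) := by
        rw [← h.proj_integralCurve hγ, ← hper 0, zero_add]
      obtain ⟨m, n, hm, hmn⟩ := exists_int_mul_eq_of_exp_smul_eq (F := E) hnot hT hclosed
      -- Rotating back at speed `H p₀` cancels the holonomy. Comparing this period with `T` at the
      -- common time `n * T = m * (2 * Real.pi)` forces `m * H p₀` to be an integer.
      have hper' : Function.Periodic (fun t : ℝ => Circle.exp (-(t * H p₀)) • γ t)
          (2 * Real.pi) := fun t => by
        simp only
        rw [h.integralCurve_add_two_pi hp₀ hγ, smul_smul, ← Circle.exp_add]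
        congr 2
        ring
      have h1 : Circle.exp (-(m * (2 * Real.pi) * H p₀)) • γ (m * (2 * Real.pi)) = γ 0 := by
        have h2 := hper'.int_mul m 0
        simpa using h2
      have h3 : γ (n * T) = γ 0 := by
        have h2 := hper.int_mul n 0
        simpa using h2
      rw [← hmn, h3, hmn] at h1
      obtain ⟨j, hj⟩ := Circle.exp_eq_one.1 (h.bundle.eq_one_of_smul_eq h1)
      have h4 : (-m : ℤ) * H p₀ = j := by
        have hpi := Real.two_pi_pos.ne'
        apply mul_right_cancel₀ hpi
        rw [← hj]
        push_cast
        ring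
      exact (hirr.intCast_mul (neg_ne_zero.2 hm)).ne_int j h4
    refine ⟨π (γ 0), hfix, ?_⟩
    have h1 := h.integralCurve_unique hγ
      (h.isMIntegralCurve_fibre (mem_fixedPoints_iff_gen.1 hfix)) (by simp)
    rw [← hrange (γ 0), ← h1]
  · rintro ⟨p, hp, rfl⟩
    obtain ⟨x, rfl⟩ := h.bundle.surjective p
    refine ⟨fun t : ℝ => Circle.exp (t * H (π x)) • x, 2 * Real.pi / H (π x),
      h.isMIntegralCurve_fibre (mem_fixedPoints_iff_gen.1 hp),
      div_pos Real.two_pi_pos (hpos _), fun t => ?_, (hrange x).symm⟩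
    simp only
    rw [add_mul, div_mul_cancel₀ _ (hpos (π x)).ne', Circle.exp_add_two_pi]

end IsHamiltonianBoothbyWang

end Main

end BoothbyWang

end

theorem mainTheorem4
    {E : Type*} [NormedAddCommGroup E] [NormedSpace ℝ E] [FiniteDimensional ℝ E]
    {B : Type*} [TopologicalSpace B] [ChartedSpace E B] [IsManifold 𝓘(ℝ, E) ∞ B]
    [T2Space B] [CompactSpace B] [ConnectedSpace B] [MulAction Circle B]
    {F : Type*} [NormedAddCommGroup F] [NormedSpace ℝ F] [FiniteDimensional ℝ F]
    {M : Type*} [TopologicalSpace M] [ChartedSpace F M] [IsManifold 𝓘(ℝ, F) ∞ M]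
    [T2Space M] [MulAction Circle M]
    (σ : BoothbyWang.DiffForm E B 2) (hσ : BoothbyWang.IsSymplecticForm σ)
    (H : B → ℝ) (hH : BoothbyWang.IsHamiltonianCircleAction σ H)
    (hfin : (MulAction.fixedPoints Circle B).Finite)
    (π : M → B) (hπ : BoothbyWang.IsPrincipalCircleBundle F E π)
    (α : BoothbyWang.DiffForm F M 1) (hα : BoothbyWang.IsConnectionForm π σ α) :
    (∃ c : ℝ, BoothbyWang.IsNormalised (fun b => H b + c)) ∧
    ∀ c : ℝ, BoothbyWang.IsNormalised (fun b => H b + c) →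
      ∀ ε : ℝ, 0 < ε → Irrational ε →
        BoothbyWang.IsContactForm (BoothbyWang.rescaled α π (fun b => H b + c) ε) ∧
        ∃ R : (x : M) → TangentSpace 𝓘(ℝ, F) x,
          (∀ R' : (x : M) → TangentSpace 𝓘(ℝ, F) x,
            BoothbyWang.IsReebField (BoothbyWang.rescaled α π (fun b => H b + c) ε) R' ↔
              R' = R) ∧
          {O : Set M | BoothbyWang.IsPeriodicOrbit R O} =
            (fun p : B => π ⁻¹' {p}) '' MulAction.fixedPoints Circle B ∧
          {O : Set M | BoothbyWang.IsPeriodicOrbit R O}.Finite := by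
  refine ⟨hH.exists_isNormalised hσ, ?_⟩
  rintro c ⟨hc, p₀, hp₀, n, hn⟩ ε hε hirr
  -- Adding constants leaves dH unchanged, so `c` and `ε` are absorbed into the Hamiltonian; its
  -- value at `p₀` becomes `n + ε`.
  have h : BoothbyWang.IsHamiltonianBoothbyWang σ (fun b => H b + c + ε) π α :=
    ⟨hσ, (hH.add_const c).add_const ε, hπ, hα⟩
  have hpos : ∀ b, 0 < H b + c + ε := fun b => add_pos (hc b) hε
  have hirr' : Irrational (H p₀ + c + ε) := by
    have hn' : H p₀ + c = n := hn
    rw [hn']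
    exact hirr.natCast_add n
  have horb : {O : Set M | BoothbyWang.IsPeriodicOrbit
      (BoothbyWang.liftField E (fun b => H b + c + ε) π α) O} =
      (fun p : B => π ⁻¹' {p}) '' MulAction.fixedPoints Circle B := by
    ext O
    exact h.isPeriodicOrbit_iff hpos hp₀ hirr' O
  refine ⟨h.isContactForm hpos, BoothbyWang.liftField E (fun b => H b + c + ε) π α,
    h.isReebField_iff hpos, horb, ?_⟩
  rw [horb]
  exact hfin.image _
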